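/- Let $M$ be a Riemann surface, $n\ge 0$ and $k\ge 2$ integers, and $\omega\in S^1$ a primitive $k$-th root of unity. In $L^2(S^1,\mathbb C^n)$ let $\mathcal H_+$ be the Hardy space of functions whose negative Fourier coefficients vanish, let $(Sf)(\lambda)=\lambda f(\lambda)$ be the shift, and put $f_\omega(\lambda)=f(\omega\lambda)$. A smooth map $\Phi:S^1\times M\to \mathrm U(n)$ with $\Phi(1,\cdot)=I$ is called an extended solution if for every local complex coordinate $z$ on $M$ there are $\mathfrak{gl}(n,\mathbb C)$-valued maps $A_z,A_{\bar z}$, independent of $\lambda$, with $\Phi(\lambda,\cdot)^{-1}d\Phi(\lambda,\cdot)=(1-\lambda^{-1})A_z\,dz+(1-\lambda)A_{\bar z}\,d\bar z$ for all $\lambda\in S^1$. A family $W=(W(p))_{p\in M}$ of subspaces of $L^2(S^1,\mathbb C^n)$ is called an extended solution if $W(p)=\Phi(\cdot,p)\mathcal H_+$ for all $p\in M$, for some extended solution $\Phi$. For families $V,V'$ of subspaces, $\partial_zV\subseteq V'$ (respectively $\lambda\partial_zV\subseteq V'$) means that for every local complex coordinate $z$ and every differentiable $L^2(S^1,\mathbb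 C^n)$-valued map $s$ on its domain with $s(p)\in V(p)$ for all $p$, one has $(\partial_zs)(p)\in V'(p)$ (respectively $S(\partial_zs)(p)\in V'(p)$) for all $p$. Let $W(p)=\Phi(\cdot,p)\mathcal H_+$, where $\Phi:S^1\times M\to\mathrm U(n)$ is smooth with $\Phi(1,\cdot)=I$, and suppose that $W$ is $k$-symmetric, i.e. $f\in W(p)$ implies $f_\omega\in W(p)$ for every $p\in M$. For $0\le j\le k-1$ let $W_j(p)=\{f\in W(p): f_\omega=\omega^jf\}$, and let $V_j(p)$ be the subspace of $L^2(S^1,\mathbb C^n)$ determined by $W_j(p)=\{\lambda\mapsto\lambda^jf(\lambda^k): f\in V_j(p)\}$, that is, $V_j(p)=\{f:\ \lambda^jf(\lambda^k)\in W_j(p)\}$. Then the following are equivalent: (i) $W$ is an extended solution; (ii) $V_0\subseteq V_1\subseteq\dots\subseteq V_{k-1}$ is a $\lambda$-cyclic superhorizontal sequence, that is, $V_j(p)\subseteq V_{j+1}(p)$ for all $p\in M$ and $0\le j<k-1$, each $V_j$ ($0\le j\le k-1$) is an extended solution, $\partial_zV_j\subseteq V_{j+1}$ for $0\le j<k-1$,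 and $\lambda\partial_zV_{k-1}\subseteq V_0$. -/

import Mathlib

open MeasureTheory
open scoped Manifold ContDiff

noncomputable section

namespace ExtSol

/-! ### The Hilbert space `L²(S¹, ℂⁿ)`, the shift, and the Hardy space -/

instance circleMeasurableSpace : MeasurableSpace Circle := borel Circle

instance circleBorelSpace : BorelSpace Circle := ⟨rfl⟩

/-- Normalised Haar (arc length) measure on the unit circle: the circle has total mass `1`. -/
def arcMeasure : Measure Circle := Measure.haarMeasure ⊤

instance arcMeasure_isHaar : arcMeasure.IsHaarMeasure := by
  unfold arcMeasure; infer_instance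

instance arcMeasure_isProb : IsProbabilityMeasure arcMeasure :=
  ⟨by simpa [arcMeasure] using Measure.haarMeasure_self (K₀ := (⊤ : TopologicalSpace.PositiveCompacts Circle))⟩

/-- The Hilbert space `L²(S¹, ℂⁿ)`. -/
abbrev L2 (n : ℕ) : Type := Lp (EuclideanSpace ℂ (Fin n)) 2 arcMeasure

theorem memLp_shift {n : ℕ} (f : L2 n) :
    MemLp (fun l : Circle => (l : ℂ) • f l) 2 arcMeasure := by
  refine (Lp.memLp f).of_le ((show Continuous fun l : Circle => (l : ℂ) from continuous_subtype_val).aestronglyMeasurable.smul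
    (Lp.aestronglyMeasurable f)) (Filter.Eventually.of_forall fun l => ?_)
  simp only [norm_smul, Circle.norm_coe, one_mul, le_refl]

/-- The forward shift `(S f)(λ) = λ f(λ)`. -/
def shift (n : ℕ) : L2 n →ₗ[ℂ] L2 n where
  toFun f := (memLp_shift f).toLp _
  map_add' f g := by
    rw [← MemLp.toLp_add, MemLp.toLp_eq_toLp_iff]
    filter_upwards [Lp.coeFn_add f g] with l hl
    simp only [hl, Pi.add_apply, smul_add]
  map_smul' c f := by
    rw [RingHom.id_apply, ← MemLp.toLp_const_smul, MemLp.toLp_eq_toLp_iff]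
    filter_upwards [Lp.coeFn_smul c f] with l hl
    simp only [hl, Pi.smul_apply, smul_comm c]

/-- The map `f ↦ f_ζ`, where `f_ζ(λ) = f(ζ λ)`. -/
def rotate (n : ℕ) (ζ : Circle) : L2 n →ₗ[ℂ] L2 n :=
  Lp.compMeasurePreservingₗ ℂ (fun l => ζ * l) (measurePreserving_mul_left arcMeasure ζ)

theorem measurePreserving_circle_pow {k : ℕ} (hk : 2 ≤ k) :
    MeasurePreserving (fun l : Circle => l ^ k) arcMeasure arcMeasure := by
  refine (powMonoidHom k : Circle →* Circle).measurePreserving (continuous_pow k) (fun z => ?_) rfl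
  refine ⟨Circle.exp (Complex.arg z / k), ?_⟩
  have h : (k : ℝ) ≠ 0 := by positivity
  rw [powMonoidHom_apply, ← Circle.exp_natCast_mul, mul_div_cancel₀ _ h, Circle.exp_arg]

/-- The map `f ↦ (λ ↦ f(λᵏ))`. -/
def powComp (n : ℕ) {k : ℕ} (hk : 2 ≤ k) : L2 n →ₗ[ℂ] L2 n :=
  Lp.compMeasurePreservingₗ ℂ (fun l => l ^ k) (measurePreserving_circle_pow hk)

/-- The Fourier coefficient `∫ λ⁻ᵐ f(λ)` of `f` of index `m`. -/
def coeff {n : ℕ} (m : ℤ) (f : L2 n) : EuclideanSpace ℂ (Fin n) :=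
  ∫ l : Circle, ((l ^ (-m) : Circle) : ℂ) • f l ∂arcMeasure

theorem integrable_coeff {n : ℕ} (m : ℤ) (f : L2 n) :
    Integrable (fun l : Circle => ((l ^ (-m) : Circle) : ℂ) • f l) arcMeasure := by
  have hf : Integrable f arcMeasure := (Lp.memLp f).integrable (by norm_num)
  refine hf.mono ((show Continuous fun l : Circle => ((l ^ (-m) : Circle) : ℂ)
    from continuous_subtype_val.comp (continuous_zpow (-m))).aestronglyMeasurable.smul
    (Lp.aestronglyMeasurable f)) (Filter.Eventually.of_forall fun l => ?_)
  simp only [norm_smul, Circle.norm_coe, one_mul, le_refl]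

/-- The Hardy space `H₊` of those `f ∈ L²(S¹, ℂⁿ)` whose negative Fourier coefficients vanish. -/
def hardy (n : ℕ) : Submodule ℂ (L2 n) where
  carrier := {f | ∀ m : ℤ, m < 0 → coeff m f = 0}
  zero_mem' m _ := by
    refine (integral_congr_ae ?_).trans (integral_zero _ _)
    filter_upwards [Lp.coeFn_zero (EuclideanSpace ℂ (Fin n)) 2 arcMeasure] with l hl
    simp only [hl, Pi.zero_apply, smul_zero]
  add_mem' {f g} hf hg m hm := by
    have h : coeff m (f + g) = coeff m f + coeff m g := by
      unfold coeff
      rw [← integral_add (integrable_coeff m f) (integrable_coeff m g)]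
      refine integral_congr_ae ?_
      filter_upwards [Lp.coeFn_add f g] with l hl
      simp only [hl, Pi.add_apply, smul_add]
    rw [h, hf m hm, hg m hm, add_zero]
  smul_mem' c f hf m hm := by
    have h : coeff m (c • f) = c • coeff m f := by
      unfold coeff
      rw [← integral_smul]
      refine integral_congr_ae ?_
      filter_upwards [Lp.coeFn_smul c f] with l hl
      simp only [hl, Pi.smul_apply, smul_comm c]
    rw [h, hf m hm, smul_zero]

/-- For a matrix-valued function `A` on the circle, the subspace `A H₊` of all `f ∈ L²(S¹, ℂⁿ)`
of the form `f(λ) = A(λ) g(λ)` (almost everywhere) with `g ∈ H₊`. -/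
def mulHardy {n : ℕ} (A : Circle → Matrix (Fin n) (Fin n) ℂ) : Submodule ℂ (L2 n) where
  carrier := {f | ∃ g ∈ hardy n, ∀ᵐ l ∂arcMeasure, f l = Matrix.toEuclideanLin (A l) (g l)}
  zero_mem' := by
    refine ⟨0, zero_mem _, ?_⟩
    filter_upwards [Lp.coeFn_zero (EuclideanSpace ℂ (Fin n)) 2 arcMeasure] with l hl
    simp only [hl, Pi.zero_apply, map_zero]
  add_mem' := by
    rintro f₁ f₂ ⟨g₁, hg₁, h₁⟩ ⟨g₂, hg₂, h₂⟩
    refine ⟨g₁ + g₂, add_mem hg₁ hg₂, ?_⟩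
    filter_upwards [h₁, h₂, Lp.coeFn_add f₁ f₂, Lp.coeFn_add g₁ g₂] with l a₁ a₂ a₃ a₄
    simp only [a₃, a₄, Pi.add_apply, a₁, a₂, map_add]
  smul_mem' := by
    rintro c f ⟨g, hg, h⟩
    refine ⟨c • g, Submodule.smul_mem _ c hg, ?_⟩
    filter_upwards [h, Lp.coeFn_smul c f, Lp.coeFn_smul c g] with l a₁ a₂ a₃
    simp only [a₂, a₃, Pi.smul_apply, a₁, map_smul]

/-! ### Symmetric subspaces and their components -/

/-- `W` is invariant under `f ↦ f_ζ`; for `ζ` a primitive `k`-th root of unity this is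
`k`-symmetry. -/
def IsSymmetric {n : ℕ} (ζ : Circle) (W : Submodule ℂ (L2 n)) : Prop :=
  ∀ f ∈ W, rotate n ζ f ∈ W

/-- The eigenspace `W_j = {f ∈ W : f_ζ = ζʲ f}`. -/
def eigenPart {n : ℕ} (ζ : Circle) (W : Submodule ℂ (L2 n)) (j : ℕ) : Submodule ℂ (L2 n) :=
  W ⊓ Module.End.eigenspace (rotate n ζ) ((ζ : ℂ) ^ j)

/-- The subspace `V_j` of all `f ∈ L²(S¹, ℂⁿ)` such that `λʲ f(λᵏ)` belongs to `W_j`.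
As `f ↦ λʲ f(λᵏ)` is injective and every `h` with `h_ζ = ζʲ h` (`ζ` a primitive `k`-th root of
unity) is of the form `λʲ f(λᵏ)`, this is the unique subspace with
`W_j = Sʲ {g : g(λ) = f(λᵏ), f ∈ V_j}`. -/
def component {n k : ℕ} (hk : 2 ≤ k) (ζ : Circle) (W : Submodule ℂ (L2 n)) (j : ℕ) :
    Submodule ℂ (L2 n) :=
  (eigenPart ζ W j).comap ((shift n ^ j) ∘ₗ powComp n hk)

/-! ### Extended solutions on a Riemann surface -/

section Surface

variable {M : Type*} [TopologicalSpace M] [ChartedSpace ℂ M] {n : ℕ}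

/-- Smoothness of `Φ : S¹ × M → U(n)`, where the complex manifold `M` is seen as a real
manifold; equivalently, all matrix entries are smooth. -/
def IsSmoothUnitary (Φ : Circle → M → Matrix.unitaryGroup (Fin n) ℂ) : Prop :=
  ∀ i j : Fin n, ContMDiff ((𝓡 1).prod 𝓘(ℝ, ℂ)) 𝓘(ℝ, ℂ) ∞
    (fun q : Circle × M => (Φ q.1 q.2 : Matrix (Fin n) (Fin n) ℂ) i j)

/-- The differential of `Φ(λ, ·)` at `p` in the local coordinate `e`, applied to the tangent
vector `v ∈ ℂ` (so that `dz(v) = v` and `dz̄(v) = v̄`). -/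
def coordDifferential (Φ : Circle → M → Matrix.unitaryGroup (Fin n) ℂ)
    (e : OpenPartialHomeomorph M ℂ) (l : Circle) (p : M) (v : ℂ) : Matrix (Fin n) (Fin n) ℂ :=
  Matrix.of fun i j =>
    fderiv ℝ (fun w : ℂ => (Φ l (e.symm w) : Matrix (Fin n) (Fin n) ℂ) i j) (e p) v

/-- Extended solutions: smooth maps `Φ : S¹ × M → U(n)` with `Φ(1, ·) = I` such that for every
local complex coordinate `z` there are matrix-valued maps `A_z`, `A_z̄` with
`Φ(λ, ·)⁻¹ dΦ(λ, ·) = (1 - λ⁻¹) A_z dz + (1 - λ) A_z̄ dz̄` for all `λ ∈ S¹`. -/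
structure IsExtendedSolution (Φ : Circle → M → Matrix.unitaryGroup (Fin n) ℂ) : Prop where
  smooth : IsSmoothUnitary Φ
  map_one : ∀ p, Φ 1 p = 1
  eqn : ∀ e ∈ IsManifold.maximalAtlas 𝓘(ℂ) ω M,
    ∃ Az Azbar : M → Matrix (Fin n) (Fin n) ℂ, ∀ (l : Circle), ∀ p ∈ e.source, ∀ v : ℂ,
      (((Φ l p)⁻¹ : Matrix.unitaryGroup (Fin n) ℂ) : Matrix (Fin n) (Fin n) ℂ) *
          coordDifferential Φ e l p v =
        ((1 - (l : ℂ)⁻¹) * v) • Az p + ((1 - (l : ℂ)) * starRingEnd ℂ v) • Azbar p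

/-- The family `z ↦ Φ(·, z) H₊` of subspaces of `L²(S¹, ℂⁿ)`. -/
def grassmannian (Φ : Circle → M → Matrix.unitaryGroup (Fin n) ℂ) (p : M) :
    Submodule ℂ (L2 n) :=
  mulHardy fun l => (Φ l p : Matrix (Fin n) (Fin n) ℂ)

/-- A family of subspaces is an extended solution if it is of the form `Φ H₊` for an extended
solution `Φ`. -/
def IsExtendedSolutionFamily (W : M → Submodule ℂ (L2 n)) : Prop :=
  ∃ Φ : Circle → M → Matrix.unitaryGroup (Fin n) ℂ,
    IsExtendedSolution Φ ∧ ∀ p, W p = grassmannian Φ p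

/-- The derivative `∂_z = (∂_x - i ∂_y) / 2` of an `L²(S¹, ℂⁿ)`-valued function of
`z = x + i y`. -/
def dz (f : ℂ → L2 n) (w : ℂ) : L2 n :=
  (1 / 2 : ℂ) • (fderiv ℝ f w 1 - Complex.I • fderiv ℝ f w Complex.I)

/-- `T ∂_z V ⊆ V'`: for every local complex coordinate `z` and every differentiable section `s`
of `V` over its domain, `T (∂_z s)` takes values in `V'`. -/
def MapsSections (T : L2 n →ₗ[ℂ] L2 n) (V V' : M → Submodule ℂ (L2 n)) : Prop :=
  ∀ e ∈ IsManifold.maximalAtlas 𝓘(ℂ) ω M, ∀ s : M → L2 n,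
    (∀ p ∈ e.source, s p ∈ V p) → DifferentiableOn ℝ (s ∘ e.symm) e.target →
      ∀ p ∈ e.source, T (dz (s ∘ e.symm) (e p)) ∈ V' p

/-- `λ`-cyclic superhorizontal sequences `V_0 ⊆ ⋯ ⊆ V_{k-1}` of length `k` (only the members
`V j` with `j < k` matter). -/
structure IsCyclicSuperhorizontal (k : ℕ) (V : ℕ → M → Submodule ℂ (L2 n)) : Prop where
  mono : ∀ j, j + 1 < k → ∀ p, V j p ≤ V (j + 1) p
  extendedSolution : ∀ j, j < k → IsExtendedSolutionFamily (V j)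
  superhorizontal : ∀ j, j + 1 < k → MapsSections LinearMap.id (V j) (V (j + 1))
  cyclic : MapsSections (shift n) (V (k - 1)) (V 0)

end Surface

end ExtSol

end

noncomputable section

namespace ExtSol

/-! ### Fourier uniqueness on the circle -/

/-! Write $U=\Phi(\cdot,p)$. A loop is determined by $UH_+$ up to a constant right factor
(`star_mul_eq_of_mulHardy_eq`), so $k$-symmetry means $U(\zeta\lambda)=U(\lambda)U(\zeta)$
(`map_mul_of_isSymmetric`). Hence $U(\zeta)^k=1$; let $P_a$ be its spectral projection for
$\zeta^a$. The function $x^{-a}U(x)P_a$ depends only on $\mu=x^k$, and so defines a piece $R_a(\mu)$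
with $R_{a+k}=\mu^{-1}R_a$ (`IsSymmetricLoop.piece_pow`, `piece_add_period`). The component $V_j$ is
$\Psi_jH_+$ for the unitary loop $\Psi_j=\sum_{r<k}R_{j-r}$, and equivalently it is the orthogonal
complement of all columns of the $R_a$ with $a>j$ (`component_eq_mulHardy_frame`,
`IsSymmetricLoop.mem_mulHardy_frame_iff`). Nestedness is then clear, and $V_k=\lambda^{-1}V_0$ turns
the cyclic condition into the case $j=k-1$ of superhorizontality.

(i) implies (ii): multiplying the equation for $U$ by $x^{-a}$ shows that $dR_a$ involves only $R_a$
and $R_{a\pm1}$ (`coordDeriv_piece`). The sum over $r$ telescopes to the extended solution equation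
for $\Psi_j$, with coefficients $P_{j+1}A$ and $P_jB$ (`coordDeriv_frame`). Differentiating $\langle
R_ac,s\rangle=0$ for a section $s$ of $V_j$ costs at most one index, so $\partial_zs$ lies in
$V_{j+1}$ (`pairing_piece_dz_eq_zero`).

(ii) implies (i): each $\Psi_j$ satisfies $\partial_z\Psi_j=(1-\mu^{-1})\Psi_jA_j$.
Superhorizontality applied to the sections $\Psi_jc$ gives $P_{j+1}A_j=A_j$
(`IsCyclicSuperhorizontal.proj_mul_eq`). From $\Psi_{j+1}-\Psi_j=(1-\mu)R_{j+1}$ one gets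
$\partial_zR_{j+1}=R_{j+1}A_j-R_{j+2}A_{j+1}$, and reassembling $U$ from its pieces gives
$\partial_zU=(1-\lambda^{-1})U\sum_jA_j$ (`exists_coordDz_eq`). Unitarity supplies the $d\bar z$
part (`coordDeriv_of_coordDz`). -/

theorem dense_span_zpow :
    (Submodule.span ℂ (Set.range fun m : ℤ =>
      (⟨fun l : Circle => ((l ^ m : Circle) : ℂ),
        continuous_subtype_val.comp (continuous_zpow m)⟩ : C(Circle, ℂ)))).topologicalClosure = ⊤ := by
  rw [Submodule.eq_top_iff']
  intro g
  have : Fact (0 < 2 * Real.pi) := ⟨by positivity⟩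
  let h := AddCircle.homeomorphCircle'
  let T := (ContinuousMap.compRightAlgHom ℂ ℂ (⟨h.symm, h.symm.continuous⟩ :
    C(Circle, AddCircle (2 * Real.pi)))).toLinearMap
  have hT : Continuous T := ContinuousMap.compRightAlgHom_continuous ℂ ℂ _
  have hg : T (g.comp ⟨h, h.continuous⟩) = g := by
    ext l
    exact congrArg g (h.apply_symm_apply l)
  have hmem : g.comp ⟨h, h.continuous⟩ ∈
      closure (Submodule.span ℂ (Set.range (@fourier (2 * Real.pi))) :
        Set C(AddCircle (2 * Real.pi), ℂ)) := by
    rw [← Submodule.topologicalClosure_coe, span_fourier_closure_eq_top]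
    trivial
  rw [← hg, ← SetLike.mem_coe, Submodule.topologicalClosure_coe]
  refine map_mem_closure hT hmem fun x hx => ?_
  refine Submodule.span_induction ?_ (by simp) (fun x y _ _ hx hy => ?_) (fun a x _ hx => ?_) hx
  · rintro _ ⟨m, rfl⟩
    refine Submodule.subset_span ⟨m, ?_⟩
    ext l
    obtain ⟨t, rfl⟩ := h.surjective l
    induction t using QuotientAddGroup.induction_on with
    | H t =>
      change ((_ : Circle) : ℂ) = fourier m (h.symm (h _))
      rw [h.symm_apply_apply, fourier_apply, AddCircle.toCircle_zsmul]
      congr 2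
      rw [AddCircle.toCircle_apply_mk]
      change Circle.exp t = _
      rw [div_self (by positivity), one_mul]
  · rw [map_add]; exact add_mem hx hy
  · rw [map_smul]; exact Submodule.smul_mem _ a hx

/-- A continuous function on the circle all of whose Fourier coefficients vanish is zero. -/
theorem eq_zero_of_integral_zpow (f : C(Circle, ℂ))
    (hf : ∀ m : ℤ, ∫ l : Circle, ((l ^ m : Circle) : ℂ) * f l ∂arcMeasure = 0) : f = 0 := by
  have key : ∀ g : C(Circle, ℂ), ∫ l : Circle, g l * f l ∂arcMeasure = 0 := by
    have hint : ∀ g : C(Circle, ℂ), Integrable (fun l : Circle => g l * f l) arcMeasure := fun g =>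
      (g * f).continuous.integrable_of_hasCompactSupport (HasCompactSupport.of_compactSpace _)
    let Φ : C(Circle, ℂ) →ₗ[ℂ] ℂ :=
      { toFun := fun g => ∫ l : Circle, g l * f l ∂arcMeasure
        map_add' := fun g h => by
          rw [← integral_add (hint g) (hint h)]
          simp only [ContinuousMap.add_apply, add_mul]
        map_smul' := fun c g => by
          simp only [ContinuousMap.smul_apply, smul_eq_mul, mul_assoc, integral_const_mul,
            RingHom.id_apply] }
    have hb : ∀ g, ‖Φ g‖ ≤ ‖f‖ * ‖g‖ := fun g => by
      have := norm_integral_le_of_norm_le_const (μ := arcMeasure) (C := ‖f‖ * ‖g‖)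
        (f := fun l => g l * f l) (Filter.Eventually.of_forall fun l => by
          rw [norm_mul, mul_comm]
          exact mul_le_mul (f.norm_coe_le_norm l) (g.norm_coe_le_norm l) (norm_nonneg _)
            (norm_nonneg _))
      rw [probReal_univ, mul_one] at this
      exact this
    let Ψ : C(Circle, ℂ) →L[ℂ] ℂ := Φ.mkContinuous _ hb
    have hle : Submodule.span ℂ (Set.range fun m : ℤ =>
      (⟨fun l : Circle => ((l ^ m : Circle) : ℂ),
        continuous_subtype_val.comp (continuous_zpow m)⟩ : C(Circle, ℂ))) ≤ LinearMap.ker Ψ.toLinearMap := by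
      rw [Submodule.span_le]
      rintro _ ⟨m, rfl⟩
      exact hf m
    have := Submodule.topologicalClosure_minimal _ hle Ψ.isClosed_ker
    rw [dense_span_zpow] at this
    exact fun g => this (Submodule.mem_top (x := g))
  -- Testing against the conjugate of `f` turns the vanishing integral into the squared $L^2$ norm.
  have h0 := key (star f)
  have h1 : ∫ l : Circle, ‖f l‖ ^ 2 ∂arcMeasure = 0 := by
    have : ∀ l, (star f) l * f l = ((‖f l‖ ^ 2 : ℝ) : ℂ) := fun l => by
      rw [ContinuousMap.star_apply, Complex.star_def, Complex.conj_mul']; push_cast; rfl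
    simp only [this] at h0
    exact_mod_cast h0
  have hc : Continuous fun l : Circle => ‖f l‖ ^ 2 := by fun_prop
  have h2 := (integral_eq_zero_iff_of_nonneg (fun l => by positivity)
    (hc.integrable_of_hasCompactSupport (HasCompactSupport.of_compactSpace _))).1 h1
  have h3 := (Continuous.ae_eq_iff_eq arcMeasure hc continuous_zero).1 h2
  ext l
  simpa using congrFun h3 l

/-! ### Testing membership in `A H₊` -/

variable {n : ℕ}

/-- The `L²` pairing of the `ℂⁿ`-valued function `A(·) c` with `f`. -/
def pairing (A : Circle → Matrix (Fin n) (Fin n) ℂ) (c : EuclideanSpace ℂ (Fin n)) (f : L2 n) : ℂ :=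
  ∫ l : Circle, inner ℂ (Matrix.toEuclideanLin (A l) c) (f l) ∂arcMeasure

theorem continuous_toEuclideanLin {X : Type*} [TopologicalSpace X]
    {A : X → Matrix (Fin n) (Fin n) ℂ} (hA : Continuous A) {c : X → EuclideanSpace ℂ (Fin n)}
    (hc : Continuous c) :
    Continuous fun x => Matrix.toEuclideanLin (A x) (c x) := by
  simp only [Matrix.toLpLin_apply]
  fun_prop

theorem inner_toEuclideanLin (A : Matrix (Fin n) (Fin n) ℂ) (c d : EuclideanSpace ℂ (Fin n)) :
    inner ℂ (Matrix.toEuclideanLin A c) d = inner ℂ c (Matrix.toEuclideanLin (star A) d) := by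
  rw [Matrix.star_eq_conjTranspose, Matrix.toEuclideanLin_conjTranspose_eq_adjoint,
    LinearMap.adjoint_inner_right]

theorem toEuclideanLin_mul (A B : Matrix (Fin n) (Fin n) ℂ) (c : EuclideanSpace ℂ (Fin n)) :
    Matrix.toEuclideanLin (A * B) c = Matrix.toEuclideanLin A (Matrix.toEuclideanLin B c) := by
  simp [Matrix.toLpLin_apply]

theorem toEuclideanLin_one (c : EuclideanSpace ℂ (Fin n)) :
    Matrix.toEuclideanLin (1 : Matrix (Fin n) (Fin n) ℂ) c = c := by
  simp

/-- The element of `L²(S¹, ℂⁿ)` given by a continuous function. -/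
def ofContinuous (n : ℕ) : C(Circle, EuclideanSpace ℂ (Fin n)) →L[ℂ] L2 n :=
  ContinuousMap.toLp 2 arcMeasure ℂ

/-- The continuous function `λ ↦ A(λ) c`. -/
def column (A : Circle → Matrix (Fin n) (Fin n) ℂ) (hA : Continuous A)
    (c : EuclideanSpace ℂ (Fin n)) : C(Circle, EuclideanSpace ℂ (Fin n)) :=
  ⟨fun l => Matrix.toEuclideanLin (A l) c, continuous_toEuclideanLin hA continuous_const⟩

theorem coeFn_ofContinuous (F : C(Circle, EuclideanSpace ℂ (Fin n))) :
    ofContinuous n F =ᵐ[arcMeasure] F :=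
  ContinuousMap.coeFn_toLp _ F

theorem pairing_eq_inner {A : Circle → Matrix (Fin n) (Fin n) ℂ} (hA : Continuous A)
    (c : EuclideanSpace ℂ (Fin n)) (f : L2 n) :
    pairing A c f = inner ℂ (ofContinuous n (column A hA c)) f := by
  rw [L2.inner_def]
  refine integral_congr_ae ?_
  filter_upwards [coeFn_ofContinuous (column A hA c)] with l hl
  rw [hl]; rfl

theorem integrable_pairing {A : Circle → Matrix (Fin n) (Fin n) ℂ} (hA : Continuous A)
    (c : EuclideanSpace ℂ (Fin n)) (f : L2 n) :
    Integrable (fun l : Circle => inner ℂ (Matrix.toEuclideanLin (A l) c) (f l)) arcMeasure := by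
  refine (L2.integrable_inner (𝕜 := ℂ) (ofContinuous n (column A hA c)) f).congr ?_
  filter_upwards [coeFn_ofContinuous (column A hA c)] with l hl
  rw [hl]; rfl

theorem pairing_sub {A B : Circle → Matrix (Fin n) (Fin n) ℂ} (hA : Continuous A)
    (hB : Continuous B) (c : EuclideanSpace ℂ (Fin n)) (f : L2 n) :
    pairing (fun l => A l - B l) c f = pairing A c f - pairing B c f := by
  unfold pairing
  rw [← integral_sub (integrable_pairing hA c f) (integrable_pairing hB c f)]
  simp only [map_sub, LinearMap.sub_apply, inner_sub_left]

theorem pairing_sum {ι : Type*} (s : Finset ι) {A : ι → Circle → Matrix (Fin n) (Fin n) ℂ}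
    (hA : ∀ i, Continuous (A i)) (c : EuclideanSpace ℂ (Fin n)) (f : L2 n) :
    pairing (fun l => ∑ i ∈ s, A i l) c f = ∑ i ∈ s, pairing (A i) c f := by
  unfold pairing
  rw [← integral_finsetSum s fun i _ => integrable_pairing (hA i) c f]
  simp only [map_sum, LinearMap.sum_apply, sum_inner]

theorem pairing_const_smul (a : ℂ) (A : Circle → Matrix (Fin n) (Fin n) ℂ)
    (c : EuclideanSpace ℂ (Fin n)) (f : L2 n) :
    pairing (fun l => a • A l) c f = starRingEnd ℂ a * pairing A c f := by
  unfold pairing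
  rw [← integral_const_mul]
  simp only [map_smul, LinearMap.smul_apply, inner_smul_left]

theorem pairing_mul_const (A : Circle → Matrix (Fin n) (Fin n) ℂ) (B : Matrix (Fin n) (Fin n) ℂ)
    (c : EuclideanSpace ℂ (Fin n)) (f : L2 n) :
    pairing (fun l => A l * B) c f = pairing A (Matrix.toEuclideanLin B c) f := by
  simp only [pairing, toEuclideanLin_mul]

theorem circle_conj_zpow (l : Circle) (m : ℤ) :
    starRingEnd ℂ ((l ^ m : Circle) : ℂ) = ((l ^ (-m) : Circle) : ℂ) := by
  rw [← Circle.coe_inv_eq_conj, zpow_neg]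

theorem continuous_coe_zpow (m : ℤ) : Continuous fun l : Circle => ((l ^ m : Circle) : ℂ) :=
  continuous_subtype_val.comp (continuous_zpow m)

theorem inner_coeff (m : ℤ) (c : EuclideanSpace ℂ (Fin n)) (g : L2 n) :
    inner ℂ c (coeff m g) = ∫ l : Circle, inner ℂ (((l ^ m : Circle) : ℂ) • c) (g l) ∂arcMeasure := by
  rw [coeff, ← integral_inner (integrable_coeff m g)]
  simp only [inner_smul_left, inner_smul_right, circle_conj_zpow]

theorem inner_unitary {U : Matrix (Fin n) (Fin n) ℂ} (hU : U ∈ Matrix.unitaryGroup (Fin n) ℂ)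
    (x y : EuclideanSpace ℂ (Fin n)) :
    inner ℂ (Matrix.toEuclideanLin U x) (Matrix.toEuclideanLin U y) = inner ℂ x y := by
  rw [inner_toEuclideanLin, ← toEuclideanLin_mul, Matrix.mem_unitaryGroup_iff'.1 hU,
    toEuclideanLin_one]

theorem norm_unitary {U : Matrix (Fin n) (Fin n) ℂ} (hU : U ∈ Matrix.unitaryGroup (Fin n) ℂ)
    (x : EuclideanSpace ℂ (Fin n)) : ‖Matrix.toEuclideanLin U x‖ = ‖x‖ := by
  rw [@norm_eq_sqrt_re_inner ℂ, @norm_eq_sqrt_re_inner ℂ _ _ _ _ x, inner_unitary hU]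

theorem aestronglyMeasurable_toEuclideanLin {A : Circle → Matrix (Fin n) (Fin n) ℂ}
    (hA : Continuous A) (f : L2 n) :
    AEStronglyMeasurable (fun l => Matrix.toEuclideanLin (A l) (f l)) arcMeasure := by
  have h : (fun l => Matrix.toEuclideanLin (A l) (f l)) = fun l =>
      ∑ j, (f l) j • Matrix.toEuclideanLin (A l) (EuclideanSpace.basisFun (Fin n) ℂ j) := by
    funext l
    conv_lhs => rw [← (EuclideanSpace.basisFun (Fin n) ℂ).sum_repr (f l)]
    simp only [map_sum, map_smul, EuclideanSpace.basisFun_repr]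
  rw [h]
  refine Finset.aestronglyMeasurable_fun_sum _ fun j _ => AEStronglyMeasurable.fun_smul ?_ ?_
  · exact (EuclideanSpace.proj (𝕜 := ℂ) j).continuous.comp_aestronglyMeasurable
      (Lp.aestronglyMeasurable f)
  · exact (continuous_toEuclideanLin hA continuous_const).aestronglyMeasurable

/-- Membership in `U H₊` for unitary `U`, tested against the functions `λᵐ U(λ) c`, `m < 0`. -/
theorem mem_mulHardy_iff {U : Circle → Matrix (Fin n) (Fin n) ℂ} (hU : Continuous U)
    (hu : ∀ l, U l ∈ Matrix.unitaryGroup (Fin n) ℂ) (f : L2 n) :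
    f ∈ mulHardy U ↔ ∀ m : ℤ, m < 0 → ∀ c, pairing (fun l => ((l ^ m : Circle) : ℂ) • U l) c f = 0 := by
  constructor
  · rintro ⟨g, hg, hfg⟩ m hm c
    have := inner_coeff m c g
    rw [hg m hm, inner_zero_right] at this
    rw [this, pairing]
    refine integral_congr_ae ?_
    filter_upwards [hfg] with l hl
    rw [hl, map_smul, LinearMap.smul_apply, ← map_smul, inner_unitary (hu l)]
  · intro h
    -- The only candidate for the Hardy factor is $U^*f$; its coefficients are the given pairings,
    -- by moving $U$ across the inner product.
    have hmem : MemLp (fun l => Matrix.toEuclideanLin (star (U l)) (f l)) 2 arcMeasure :=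
      (Lp.memLp f).of_le (aestronglyMeasurable_toEuclideanLin hU.star f)
        (Filter.Eventually.of_forall fun l => (norm_unitary (Unitary.star_mem (hu l)) _).le)
    refine ⟨hmem.toLp _, fun m hm => ?_, ?_⟩
    · refine ext_inner_left ℂ fun c => ?_
      rw [inner_zero_right, inner_coeff, ← h m hm c]
      refine integral_congr_ae ?_
      filter_upwards [hmem.coeFn_toLp] with l hl
      rw [hl, ← inner_toEuclideanLin, map_smul, map_smul, LinearMap.smul_apply]
    · filter_upwards [hmem.coeFn_toLp] with l hl
      rw [hl, ← toEuclideanLin_mul, (Matrix.mem_unitaryGroup_iff).1 (hu l), toEuclideanLin_one]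

/-- Pairing of two columns. -/
theorem pairing_column {A B : Circle → Matrix (Fin n) (Fin n) ℂ} (hB : Continuous B)
    (c d : EuclideanSpace ℂ (Fin n)) :
    pairing A c (ofContinuous n (column B hB d)) =
      ∫ l : Circle, inner ℂ (Matrix.toEuclideanLin (A l) c) (Matrix.toEuclideanLin (B l) d)
        ∂arcMeasure := by
  refine integral_congr_ae ?_
  filter_upwards [coeFn_ofContinuous (column B hB d)] with l hl
  rw [hl]; rfl

/-- Translation by a point whose `m`-th power is $-1$ preserves the integral and reverses its sign.
-/
theorem integral_coe_zpow {m : ℤ} (hm : m ≠ 0) :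
    ∫ l : Circle, ((l ^ m : Circle) : ℂ) ∂arcMeasure = 0 := by
  let z := Circle.exp (Real.pi / m)
  have hz : z ^ m = Circle.exp Real.pi := by
    rw [← Circle.exp_intCast_mul]
    congr 1
    field_simp
  have h := integral_mul_left_eq_self (μ := arcMeasure) (fun l : Circle => ((l ^ m : Circle) : ℂ)) z
  simp only [mul_zpow, hz, Circle.coe_mul, integral_const_mul] at h
  have h2 : ((Circle.exp Real.pi : Circle) : ℂ) = -1 := by
    rw [Circle.coe_exp, Complex.exp_pi_mul_I]
  rw [h2] at h
  linear_combination (-1 / 2 : ℂ) * h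

theorem column_mem_mulHardy {U : Circle → Matrix (Fin n) (Fin n) ℂ} (hU : Continuous U)
    (hu : ∀ l, U l ∈ Matrix.unitaryGroup (Fin n) ℂ) (c : EuclideanSpace ℂ (Fin n)) :
    ofContinuous n (column U hU c) ∈ mulHardy U := by
  rw [mem_mulHardy_iff hU hu]
  intro m hm d
  rw [pairing_column]
  simp only [map_smul, LinearMap.smul_apply, inner_smul_left, inner_unitary (hu _),
    circle_conj_zpow, integral_mul_const]
  rw [integral_coe_zpow (by lia), zero_mul]

/-- If `U H₊ = U' H₊`, then `U'⁻¹ U` is constant. -/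
theorem star_mul_eq_of_mulHardy_eq {U U' : Circle → Matrix (Fin n) (Fin n) ℂ} (hU : Continuous U)
    (hu : ∀ l, U l ∈ Matrix.unitaryGroup (Fin n) ℂ) (hU' : Continuous U')
    (hu' : ∀ l, U' l ∈ Matrix.unitaryGroup (Fin n) ℂ) (h : mulHardy U = mulHardy U') (l : Circle) :
    star (U' l) * U l = star (U' 1) * U 1 := by
  have key : ∀ c d : EuclideanSpace ℂ (Fin n), ∀ l,
      inner ℂ (Matrix.toEuclideanLin (U' l) d) (Matrix.toEuclideanLin (U l) c) =
      inner ℂ (Matrix.toEuclideanLin (U' 1) d) (Matrix.toEuclideanLin (U 1) c) := by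
    intro c d
    have hcont : Continuous fun l : Circle =>
        (inner ℂ (Matrix.toEuclideanLin (U' l) d) (Matrix.toEuclideanLin (U l) c) : ℂ) :=
      (continuous_toEuclideanLin hU' continuous_const).inner
        (continuous_toEuclideanLin hU continuous_const)
    let F : C(Circle, ℂ) := ⟨_, hcont⟩
    -- Each inclusion between the two spaces kills the coefficients of one sign: $U'd\in UH_+$
    -- handles $m<0$ and $Uc\in U'H_+$ handles $m>0$. Only the mean survives.
    have hpos : ∀ m : ℤ, m ≠ 0 → ∫ l : Circle, ((l ^ m : Circle) : ℂ) * F l ∂arcMeasure = 0 := by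
      intro m hm
      rcases lt_or_gt_of_ne hm with hm | hm
      · have := (mem_mulHardy_iff hU hu _).1 (h ▸ column_mem_mulHardy hU' hu' d) m hm c
        rw [pairing_column] at this
        rw [← (starRingEnd ℂ).map_zero, ← this, ← integral_conj]
        refine integral_congr_ae (Filter.Eventually.of_forall fun l => ?_)
        simp only [LinearMap.smul_apply, map_smul, inner_smul_left, map_mul,
          Complex.conj_conj, inner_conj_symm]
        rfl
      · have := (mem_mulHardy_iff hU' hu' _).1 (h ▸ column_mem_mulHardy hU hu c) (-m) (by lia) d
        rw [pairing_column] at this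
        rw [← this]
        refine integral_congr_ae (Filter.Eventually.of_forall fun l => ?_)
        simp only [LinearMap.smul_apply, map_smul, inner_smul_left, circle_conj_zpow, neg_neg]
        rfl
    let a : ℂ := ∫ l : Circle, F l ∂arcMeasure
    have hz : F - ContinuousMap.const _ a = 0 := by
      refine eq_zero_of_integral_zpow _ fun m => ?_
      have hi : Integrable (fun l : Circle => ((l ^ m : Circle) : ℂ) * F l) arcMeasure :=
        ((continuous_coe_zpow m).mul F.continuous).integrable_of_hasCompactSupport
          (HasCompactSupport.of_compactSpace _)
      have hi' : Integrable (fun l : Circle => ((l ^ m : Circle) : ℂ) * a) arcMeasure :=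
        ((continuous_coe_zpow m).mul continuous_const).integrable_of_hasCompactSupport
          (HasCompactSupport.of_compactSpace _)
      simp only [ContinuousMap.sub_apply, ContinuousMap.const_apply, mul_sub]
      rw [integral_sub hi hi', integral_mul_const]
      by_cases hm : m = 0
      · subst hm
        simp [a]
      · rw [hpos m hm, integral_coe_zpow hm, zero_mul, sub_zero]
    have hF : ∀ l, F l = a := fun l => by
      have := DFunLike.congr_fun hz l
      simpa [sub_eq_zero] using this
    intro l
    exact (hF l).trans (hF 1).symm
  refine Matrix.toEuclideanLin.injective (LinearMap.ext fun c => ext_inner_left ℂ fun d => ?_)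
  rw [toEuclideanLin_mul, toEuclideanLin_mul, ← inner_toEuclideanLin, ← inner_toEuclideanLin, key]

/-- `U H₊ = U' H₊` and `U(1) = U'(1) = 1` imply `U = U'`. -/
theorem eq_of_mulHardy_eq {U U' : Circle → Matrix (Fin n) (Fin n) ℂ} (hU : Continuous U)
    (hu : ∀ l, U l ∈ Matrix.unitaryGroup (Fin n) ℂ) (hU' : Continuous U')
    (hu' : ∀ l, U' l ∈ Matrix.unitaryGroup (Fin n) ℂ) (h1 : U 1 = 1) (h1' : U' 1 = 1)
    (h : mulHardy U = mulHardy U') : U = U' := by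
  funext l
  have := star_mul_eq_of_mulHardy_eq hU hu hU' hu' h l
  rw [h1, h1', star_one, mul_one] at this
  rw [← one_mul (U l), ← Matrix.mem_unitaryGroup_iff.1 (hu' l), mul_assoc, this, mul_one]

/-! ### Rotations, powers and shifts acting on $L^2$; the loop identity equivalent to symmetry -/

theorem coeFn_rotate (ζ : Circle) (f : L2 n) :
    rotate n ζ f =ᵐ[arcMeasure] fun l => f (ζ * l) :=
  Lp.coeFn_compMeasurePreserving f (measurePreserving_mul_left arcMeasure ζ)

theorem coeff_rotate (ζ : Circle) (m : ℤ) (f : L2 n) :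
    coeff m (rotate n ζ f) = ((ζ ^ m : Circle) : ℂ) • coeff m f := by
  unfold coeff
  rw [← integral_mul_left_eq_self (fun l : Circle => ((l ^ (-m) : Circle) : ℂ) • f l) ζ,
    ← integral_smul]
  refine integral_congr_ae ?_
  filter_upwards [coeFn_rotate ζ f] with l hl
  rw [hl, smul_smul, ← Circle.coe_mul, mul_zpow, ← mul_assoc, zpow_neg ζ, mul_inv_cancel, one_mul]

theorem rotate_mem_mulHardy {A : Circle → Matrix (Fin n) (Fin n) ℂ} (ζ : Circle) {f : L2 n}
    (hf : f ∈ mulHardy A) : rotate n ζ f ∈ mulHardy fun l => A (ζ * l) := by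
  obtain ⟨g, hg, h⟩ := hf
  refine ⟨rotate n ζ g, fun m hm => ?_, ?_⟩
  · rw [coeff_rotate, hg m hm, smul_zero]
  · filter_upwards [coeFn_rotate ζ f, coeFn_rotate ζ g,
      (measurePreserving_mul_left arcMeasure ζ).quasiMeasurePreserving.ae h] with l h1 h2 h3
    rw [h1, h2, h3]

theorem rotate_rotate (ζ ξ : Circle) (f : L2 n) : rotate n ζ (rotate n ξ f) = rotate n (ξ * ζ) f := by
  refine Lp.ext ?_
  filter_upwards [coeFn_rotate ζ (rotate n ξ f), coeFn_rotate (ξ * ζ) f,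
    (measurePreserving_mul_left arcMeasure ζ).quasiMeasurePreserving.ae (coeFn_rotate ξ f)]
    with l h1 h2 h3
  rw [h1, h2, h3, mul_assoc]

theorem rotate_one (f : L2 n) : rotate n 1 f = f := by
  refine Lp.ext ?_
  filter_upwards [coeFn_rotate 1 f] with l h1
  rw [h1, one_mul]

theorem mem_of_rotate_pow {ζ : Circle} {W : Submodule ℂ (L2 n)} (hW : IsSymmetric ζ W) (i : ℕ)
    {f : L2 n} (hf : f ∈ W) : rotate n (ζ ^ i) f ∈ W := by
  induction i with
  | zero => rwa [pow_zero, rotate_one]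
  | succ i ih => rw [pow_succ, ← rotate_rotate]; exact hW _ ih

/-- A symmetric subspace `U H₊` has `U(ζλ) = U(λ) U(ζ)`. -/
theorem map_mul_of_isSymmetric {U : Circle → Matrix (Fin n) (Fin n) ℂ} (hU : Continuous U)
    (hu : ∀ l, U l ∈ Matrix.unitaryGroup (Fin n) ℂ) (h1 : U 1 = 1) {ζ : Circle} {k : ℕ}
    (hk : k ≠ 0) (hζ : ζ ^ k = 1) (hW : IsSymmetric ζ (mulHardy U)) (l : Circle) :
    U (ζ * l) = U l * U ζ := by
  have hinv : ζ ^ (k - 1) = ζ⁻¹ := by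
    rw [eq_inv_iff_mul_eq_one, ← pow_succ, Nat.sub_add_cancel (Nat.one_le_iff_ne_zero.2 hk), hζ]
  -- Symmetry is only assumed in one direction; the reverse inclusion rotates by
  -- $\zeta^{k-1}=\zeta^{-1}$. The rotated loop then differs from `U` by a constant, evaluated at
  -- $\lambda=1$.
  have heq : mulHardy (fun l => U (ζ * l)) = mulHardy U := by
    apply le_antisymm
    · intro f hf
      have := rotate_mem_mulHardy ζ⁻¹ hf
      simp only [mul_inv_cancel_left] at this
      have h2 := hW _ this
      rwa [rotate_rotate, inv_mul_cancel, rotate_one] at h2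
    · intro f hf
      have := rotate_mem_mulHardy ζ (mem_of_rotate_pow hW (k - 1) hf)
      rwa [rotate_rotate, hinv, inv_mul_cancel, rotate_one] at this
  have := star_mul_eq_of_mulHardy_eq (hU.comp (continuous_const_mul ζ)) (fun l => hu _) hU hu heq l
  simp only [Function.comp, mul_one, h1, star_one, one_mul] at this
  rw [← this, ← mul_assoc, Matrix.mem_unitaryGroup_iff.1 (hu l), one_mul]

theorem coeFn_powComp {k : ℕ} (hk : 2 ≤ k) (f : L2 n) :
    powComp n hk f =ᵐ[arcMeasure] fun l => f (l ^ k) :=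
  Lp.coeFn_compMeasurePreserving f (measurePreserving_circle_pow hk)

theorem coeFn_shift (f : L2 n) : shift n f =ᵐ[arcMeasure] fun l => (l : ℂ) • f l :=
  (memLp_shift f).coeFn_toLp

theorem coeFn_shift_pow (j : ℕ) (f : L2 n) :
    (shift n ^ j) f =ᵐ[arcMeasure] fun l => ((l ^ (j : ℤ) : Circle) : ℂ) • f l := by
  induction j with
  | zero => simp
  | succ j ih =>
    rw [pow_succ', Module.End.mul_apply]
    filter_upwards [ih, coeFn_shift ((shift n ^ j) f)] with l h1 h2
    rw [h2, h1, smul_smul, Nat.cast_succ, ← Circle.coe_mul, zpow_add_one, mul_comm]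

theorem pairing_shift (A : Circle → Matrix (Fin n) (Fin n) ℂ) (c : EuclideanSpace ℂ (Fin n))
    (f : L2 n) :
    pairing A c (shift n f) = pairing (fun l => ((l⁻¹ : Circle) : ℂ) • A l) c f := by
  refine integral_congr_ae ?_
  filter_upwards [coeFn_shift f] with l hl
  rw [hl, inner_smul_right, map_smul, LinearMap.smul_apply, inner_smul_left,
    Circle.coe_inv_eq_conj, Complex.conj_conj]

end ExtSol

end

noncomputable section

namespace ExtSol

/-! ### The homogeneous pieces of a symmetric loop -/

variable {n k : ℕ} {ζ : Circle} {U : Circle → Matrix (Fin n) (Fin n) ℂ}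

/-- A `k`-th root of a point of the circle. -/
def circleRoot (k : ℕ) (μ : Circle) : Circle := Circle.exp (Complex.arg μ / k)

theorem circleRoot_pow (hk : k ≠ 0) (μ : Circle) : circleRoot k μ ^ k = μ := by
  rw [circleRoot, ← Circle.exp_natCast_mul, mul_div_cancel₀ _ (Nat.cast_ne_zero.2 hk),
    Circle.exp_arg]

theorem exists_eq_pow_mul (hk : k ≠ 0) (hζ : IsPrimitiveRoot ζ k) {x y : Circle}
    (h : x ^ k = y ^ k) : ∃ i, x = ζ ^ i * y := by
  have : NeZero k := ⟨hk⟩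
  have hζ' : IsPrimitiveRoot (ζ : ℂ) k :=
    hζ.map_of_injective (f := Circle.coeHom) Circle.coe_injective
  have h1 : (((x / y : Circle) : ℂ)) ^ k = 1 := by
    rw [← Circle.coe_pow, div_pow, h, div_self', Circle.coe_one]
  obtain ⟨i, -, hi⟩ := hζ'.eq_pow_of_pow_eq_one h1
  refine ⟨i, ?_⟩
  rw [← Circle.coe_pow] at hi
  rw [Circle.coe_injective hi, div_mul_cancel]

/-- Points with equal `k`-th powers differ by a power of `ζ`, which permutes the summands
cyclically. -/
theorem sum_rotations_eq {V : Type*} [AddCommMonoid V] (hk : k ≠ 0) (hζ : IsPrimitiveRoot ζ k)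
    (g : Circle → V) {x y : Circle} (h : x ^ k = y ^ k) :
    ∑ i ∈ Finset.range k, g (ζ ^ i * x) = ∑ i ∈ Finset.range k, g (ζ ^ i * y) := by
  have step : ∀ z, ∑ i ∈ Finset.range k, g (ζ ^ i * (ζ * z)) = ∑ i ∈ Finset.range k, g (ζ ^ i * z) := by
    intro z
    obtain ⟨m, rfl⟩ := Nat.exists_eq_succ_of_ne_zero hk
    rw [Finset.sum_range_succ, Finset.sum_range_succ']
    simp only [← mul_assoc, ← pow_succ, hζ.pow_eq_one, pow_zero]
  obtain ⟨i, rfl⟩ := exists_eq_pow_mul hk hζ h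
  clear h
  induction i with
  | zero => simp
  | succ i ih => rw [pow_succ', mul_assoc, step, ih]

/-- For `x` with `xᵏ = μ`, the mean of `y⁻ᵃ U(y)` over the `k` points `y` with `yᵏ = μ`. -/
def piece (k : ℕ) (ζ : Circle) (U : Circle → Matrix (Fin n) (Fin n) ℂ) (a : ℤ) (μ : Circle) :
    Matrix (Fin n) (Fin n) ℂ :=
  (k : ℂ)⁻¹ • ∑ i ∈ Finset.range k,
    (((ζ ^ i * circleRoot k μ) ^ (-a) : Circle) : ℂ) • U (ζ ^ i * circleRoot k μ)

/-- Frees the pieces from the discontinuous choice made in `circleRoot`; continuity and smoothness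
rest on it. -/
theorem piece_eq (hk : k ≠ 0) (hζ : IsPrimitiveRoot ζ k) (U : Circle → Matrix (Fin n) (Fin n) ℂ)
    (a : ℤ) {x μ : Circle} (hx : x ^ k = μ) :
    piece k ζ U a μ = (k : ℂ)⁻¹ • ∑ i ∈ Finset.range k,
      (((ζ ^ i * x) ^ (-a) : Circle) : ℂ) • U (ζ ^ i * x) := by
  rw [piece, sum_rotations_eq hk hζ (fun y => ((y ^ (-a) : Circle) : ℂ) • U y)
    ((circleRoot_pow hk μ).trans hx.symm)]

theorem continuous_piece (hk : k ≠ 0) (hζ : IsPrimitiveRoot ζ k) (hU : Continuous U) (a : ℤ) :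
    Continuous (piece k ζ U a) := by
  have hq : Topology.IsQuotientMap fun x : Circle => x ^ k :=
    (continuous_pow k).isClosedMap.isQuotientMap (continuous_pow k)
      fun μ => ⟨circleRoot k μ, circleRoot_pow hk μ⟩
  rw [hq.continuous_iff]
  have : piece k ζ U a ∘ (fun x : Circle => x ^ k) = fun x => (k : ℂ)⁻¹ • ∑ i ∈ Finset.range k,
      (((ζ ^ i * x) ^ (-a) : Circle) : ℂ) • U (ζ ^ i * x) :=
    funext fun x => piece_eq hk hζ U a rfl
  rw [this]
  refine Continuous.const_smul (continuous_finsetSum _ fun i _ => ?_) (k : ℂ)⁻¹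
  have hi : Continuous fun x : Circle => ζ ^ i * x := continuous_const_mul _
  exact ((continuous_coe_zpow (-a)).comp hi).smul (hU.comp hi)

theorem piece_add_period (hk : k ≠ 0) (hζ : IsPrimitiveRoot ζ k)
    (U : Circle → Matrix (Fin n) (Fin n) ℂ) (a : ℤ) (μ : Circle) :
    piece k ζ U (a + k) μ = ((μ⁻¹ : Circle) : ℂ) • piece k ζ U a μ := by
  rw [piece, piece, smul_comm, Finset.smul_sum (r := ((μ⁻¹ : Circle) : ℂ))]
  congr 1
  refine Finset.sum_congr rfl fun i _ => ?_
  rw [smul_smul, ← Circle.coe_mul, neg_add, zpow_add, zpow_neg _ (k : ℤ), zpow_natCast, mul_pow,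
    circleRoot_pow hk, ← pow_mul, mul_comm i k, pow_mul, hζ.pow_eq_one, one_pow, one_mul, mul_comm]

theorem piece_sub_period (hk : k ≠ 0) (hζ : IsPrimitiveRoot ζ k)
    (U : Circle → Matrix (Fin n) (Fin n) ℂ) (a : ℤ) (μ : Circle) :
    piece k ζ U (a - k) μ = (μ : ℂ) • piece k ζ U a μ := by
  have := piece_add_period hk hζ U (a - k) μ
  rw [sub_add_cancel] at this
  rw [this, smul_smul, ← Circle.coe_mul, mul_inv_cancel, Circle.coe_one, one_smul]

theorem piece_sub_mul_period (hk : k ≠ 0) (hζ : IsPrimitiveRoot ζ k)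
    (U : Circle → Matrix (Fin n) (Fin n) ℂ) (a q : ℤ) (μ : Circle) :
    piece k ζ U (a - k * q) μ = ((μ ^ q : Circle) : ℂ) • piece k ζ U a μ := by
  induction q using Int.induction_on with
  | zero => simp
  | succ i ih =>
    rw [show a - (k : ℤ) * (i + 1) = a - k * i - k by ring, piece_sub_period hk hζ, ih, smul_smul,
      ← Circle.coe_mul, zpow_add_one, mul_comm]
  | pred i ih =>
    rw [show a - (k : ℤ) * (-i - 1) = a - k * (-i) + k by ring, piece_add_period hk hζ, ih,
      smul_smul, ← Circle.coe_mul, zpow_sub_one, mul_comm]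

/-- A continuous loop of unitary matrices, based at `1`, with `U(ζλ) = U(λ) U(ζ)`. -/
structure IsSymmetricLoop (ζ : Circle) (U : Circle → Matrix (Fin n) (Fin n) ℂ) : Prop where
  continuous : Continuous U
  mem_unitary : ∀ l, U l ∈ Matrix.unitaryGroup (Fin n) ℂ
  map_one : U 1 = 1
  map_mul : ∀ l, U (ζ * l) = U l * U ζ

/-- The spectral projections of `U(ζ)`. -/
def proj (k : ℕ) (ζ : Circle) (U : Circle → Matrix (Fin n) (Fin n) ℂ) (a : ℤ) :
    Matrix (Fin n) (Fin n) ℂ :=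
  piece k ζ U a 1

theorem proj_add_period (hk : k ≠ 0) (hζ : IsPrimitiveRoot ζ k)
    (U : Circle → Matrix (Fin n) (Fin n) ℂ) (a : ℤ) :
    proj k ζ U (a + k) = proj k ζ U a := by
  simp [proj, piece_add_period hk hζ]

theorem proj_eq (hk : k ≠ 0) (hζ : IsPrimitiveRoot ζ k) (U : Circle → Matrix (Fin n) (Fin n) ℂ)
    (a : ℤ) : proj k ζ U a = (k : ℂ)⁻¹ • ∑ i ∈ Finset.range k,
      (((ζ ^ i) ^ (-a) : Circle) : ℂ) • U (ζ ^ i) := by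
  rw [proj, piece_eq hk hζ U a (one_pow k)]
  simp only [mul_one]

theorem IsSymmetricLoop.map_pow_mul (hU : IsSymmetricLoop ζ U) (i : ℕ) (l : Circle) :
    U (ζ ^ i * l) = U l * U (ζ ^ i) := by
  induction i generalizing l with
  | zero => simp [hU.map_one]
  | succ i ih =>
    rw [pow_succ, mul_assoc, ih, hU.map_mul, ih ζ, mul_assoc]

/-- Since $U(\zeta^ix)=U(x)U(\zeta^i)$, the factor $x^{-a}U(x)$ comes out of the mean and leaves the
spectral projection. -/
theorem IsSymmetricLoop.piece_pow (hU : IsSymmetricLoop ζ U) (hk : k ≠ 0)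
    (hζ : IsPrimitiveRoot ζ k) (a : ℤ) (x : Circle) :
    piece k ζ U a (x ^ k) = ((x ^ (-a) : Circle) : ℂ) • (U x * proj k ζ U a) := by
  rw [piece_eq hk hζ U a rfl, proj_eq hk hζ, Matrix.mul_smul, Finset.mul_sum, smul_comm,
    Finset.smul_sum (r := ((x ^ (-a) : Circle) : ℂ))]
  congr 1
  refine Finset.sum_congr rfl fun i _ => ?_
  rw [Matrix.mul_smul, smul_smul, ← Circle.coe_mul, ← mul_zpow, hU.map_pow_mul, mul_comm x]

theorem zpow_primitive_eq_one_iff (hζ : IsPrimitiveRoot ζ k) (a : ℤ) :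
    ((ζ ^ a : Circle) : ℂ) = 1 ↔ (k : ℤ) ∣ a := by
  rw [← hζ.zpow_eq_one_iff_dvd, ← Circle.coe_one, Circle.coe_inj]

theorem IsSymmetricLoop.mul_proj (hU : IsSymmetricLoop ζ U) (hk : k ≠ 0)
    (hζ : IsPrimitiveRoot ζ k) (a : ℤ) :
    U ζ * proj k ζ U a = ((ζ ^ a : Circle) : ℂ) • proj k ζ U a := by
  have h := hU.piece_pow hk hζ a ζ
  rw [hζ.pow_eq_one] at h
  change proj k ζ U a = _ at h
  conv_rhs => rw [h]
  rw [smul_smul, ← Circle.coe_mul, ← zpow_add, add_neg_cancel, zpow_zero, Circle.coe_one, one_smul]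

/-- Eigenspaces of the unitary matrix $U(\zeta)$ for distinct eigenvalues $\zeta^a\neq\zeta^b$ are
orthogonal. -/
theorem IsSymmetricLoop.star_proj_mul_proj (hU : IsSymmetricLoop ζ U) (hk : k ≠ 0)
    (hζ : IsPrimitiveRoot ζ k) {a b : ℤ} (hab : ¬ (k : ℤ) ∣ b - a) :
    star (proj k ζ U a) * proj k ζ U b = 0 := by
  have h : star (U ζ * proj k ζ U a) * (U ζ * proj k ζ U b) =
      star (proj k ζ U a) * proj k ζ U b := by
    rw [star_mul, mul_assoc, ← mul_assoc (star (U ζ)),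
      Matrix.mem_unitaryGroup_iff'.1 (hU.mem_unitary ζ), one_mul]
  rw [hU.mul_proj hk hζ, hU.mul_proj hk hζ, star_smul, Complex.star_def, circle_conj_zpow,
    Matrix.smul_mul, Matrix.mul_smul, smul_smul, ← Circle.coe_mul, ← zpow_add] at h
  have hne : ((ζ ^ (-a + b) : Circle) : ℂ) - 1 ≠ 0 := fun h0 =>
    hab (by rw [sub_eq_neg_add, ← zpow_primitive_eq_one_iff hζ]; exact sub_eq_zero.1 h0)
  have h2 : (((ζ ^ (-a + b) : Circle) : ℂ) - 1) • (star (proj k ζ U a) * proj k ζ U b) = 0 := by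
    rw [sub_smul, one_smul, h, sub_self]
  exact (smul_eq_zero.1 h2).resolve_left hne

/-- After exchanging the sums, each $i\neq0$ contributes a full geometric sum of a nontrivial `k`-th
root of unity, which is zero. -/
theorem IsSymmetricLoop.sum_proj (hU : IsSymmetricLoop ζ U) (hk : k ≠ 0)
    (hζ : IsPrimitiveRoot ζ k) (j : ℤ) : ∑ r ∈ Finset.range k, proj k ζ U (j - r) = 1 := by
  simp only [proj_eq hk hζ, ← Finset.smul_sum]
  rw [Finset.sum_comm]
  simp only [← Finset.sum_smul]
  rw [Finset.sum_eq_single 0]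
  · simp [hU.map_one, hk]
  · intro i hi hi0
    have hsum : ∑ r ∈ Finset.range k, (((ζ ^ i) ^ (-(j - (r : ℤ))) : Circle) : ℂ) = 0 := by
      have hne : ((ζ ^ i : Circle) : ℂ) ≠ 1 := by
        rw [← zpow_natCast, Ne, zpow_primitive_eq_one_iff hζ, Int.natCast_dvd_natCast]
        exact Nat.not_dvd_of_pos_of_lt (Nat.pos_of_ne_zero hi0) (Finset.mem_range.1 hi)
      have hg := mul_geom_sum (((ζ ^ i : Circle) : ℂ)) k
      rw [← Circle.coe_pow, ← pow_mul, mul_comm i k, pow_mul, hζ.pow_eq_one, one_pow,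
        Circle.coe_one, sub_self] at hg
      have hg0 := (mul_eq_zero.1 hg).resolve_left (sub_ne_zero.2 hne)
      have : ∀ r : ℕ, (((ζ ^ i) ^ (-(j - (r : ℤ))) : Circle) : ℂ) =
          (((ζ ^ i) ^ (-j) : Circle) : ℂ) * ((ζ ^ i : Circle) : ℂ) ^ r := fun r => by
        rw [← Circle.coe_pow, ← Circle.coe_mul, ← zpow_natCast (ζ ^ i) r, ← zpow_add, neg_sub,
          sub_eq_neg_add]
      simp only [this, ← Finset.mul_sum, hg0, mul_zero]
    rw [hsum, zero_smul]
  · intro h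
    exact absurd (Finset.mem_range.2 (Nat.pos_of_ne_zero hk)) h

theorem not_dvd_of_mem_range {a : ℤ} {r s : ℕ} (hr : r ∈ Finset.range k) (hs : s ∈ Finset.range k)
    (hrs : s ≠ r) : ¬ (k : ℤ) ∣ (a - s) - (a - r) := by
  rw [Finset.mem_range] at hr hs
  rintro ⟨q, hq⟩
  have h1 : (k : ℤ) * q < k * 1 := by lia
  have h2 : (k : ℤ) * (-1) < k * q := by lia
  have hk : (0 : ℤ) < k := by lia
  have := lt_of_mul_lt_mul_left h1 hk.le
  have := lt_of_mul_lt_mul_left h2 hk.le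
  have : q = 0 := by lia
  subst this
  lia

/-- Expand the identity in $P_a^*\cdot 1$ as the sum of all projections; orthogonality leaves one
term. As $P_a^*P_a$ is self-adjoint, so is $P_a$. -/
theorem IsSymmetricLoop.star_proj_mul_self (hU : IsSymmetricLoop ζ U) (hk : k ≠ 0)
    (hζ : IsPrimitiveRoot ζ k) (a : ℤ) :
    star (proj k ζ U a) * proj k ζ U a = star (proj k ζ U a) := by
  conv_rhs => rw [← mul_one (star (proj k ζ U a)), ← hU.sum_proj hk hζ a, Finset.mul_sum]
  have h0 : 0 ∈ Finset.range k := Finset.mem_range.2 (Nat.pos_of_ne_zero hk)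
  rw [Finset.sum_eq_single_of_mem 0 h0 fun r hr hr0 => ?_]
  · simp
  · refine hU.star_proj_mul_proj hk hζ ?_
    simpa using not_dvd_of_mem_range (a := a) h0 hr hr0

theorem IsSymmetricLoop.star_proj (hU : IsSymmetricLoop ζ U) (hk : k ≠ 0)
    (hζ : IsPrimitiveRoot ζ k) (a : ℤ) : star (proj k ζ U a) = proj k ζ U a := by
  have h := hU.star_proj_mul_self hk hζ a
  have h2 := congrArg star h
  rw [star_mul, star_star] at h2
  exact h.symm.trans h2

theorem IsSymmetricLoop.proj_mul_self (hU : IsSymmetricLoop ζ U) (hk : k ≠ 0)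
    (hζ : IsPrimitiveRoot ζ k) (a : ℤ) : proj k ζ U a * proj k ζ U a = proj k ζ U a := by
  simpa only [hU.star_proj hk hζ a] using hU.star_proj_mul_self hk hζ a

theorem IsSymmetricLoop.proj_mul_proj (hU : IsSymmetricLoop ζ U) (hk : k ≠ 0)
    (hζ : IsPrimitiveRoot ζ k) {a b : ℤ} (hab : ¬ (k : ℤ) ∣ b - a) :
    proj k ζ U a * proj k ζ U b = 0 := by
  simpa only [hU.star_proj hk hζ a] using hU.star_proj_mul_proj hk hζ hab

theorem IsSymmetricLoop.piece_mul_proj_self (hU : IsSymmetricLoop ζ U) (hk : k ≠ 0)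
    (hζ : IsPrimitiveRoot ζ k) (a : ℤ) (μ : Circle) :
    piece k ζ U a μ * proj k ζ U a = piece k ζ U a μ := by
  rw [← circleRoot_pow hk μ, hU.piece_pow hk hζ, Matrix.smul_mul, mul_assoc,
    hU.proj_mul_self hk hζ]

theorem IsSymmetricLoop.piece_mul_proj (hU : IsSymmetricLoop ζ U) (hk : k ≠ 0)
    (hζ : IsPrimitiveRoot ζ k) {a b : ℤ} (hab : ¬ (k : ℤ) ∣ b - a) (μ : Circle) :
    piece k ζ U a μ * proj k ζ U b = 0 := by
  rw [← circleRoot_pow hk μ, hU.piece_pow hk hζ, Matrix.smul_mul, mul_assoc,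
    hU.proj_mul_proj hk hζ hab, mul_zero, smul_zero]

/-- The loop whose Grassmannian image is the `j`-th component of that of `U`. -/
def frame (k : ℕ) (ζ : Circle) (U : Circle → Matrix (Fin n) (Fin n) ℂ) (j : ℤ) (μ : Circle) :
    Matrix (Fin n) (Fin n) ℂ :=
  ∑ r ∈ Finset.range k, piece k ζ U (j - r) μ

theorem continuous_frame (hk : k ≠ 0) (hζ : IsPrimitiveRoot ζ k) (hU : Continuous U) (j : ℤ) :
    Continuous (frame k ζ U j) :=
  continuous_finsetSum _ fun _ _ => continuous_piece hk hζ hU _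

theorem IsSymmetricLoop.frame_mul_proj (hU : IsSymmetricLoop ζ U) (hk : k ≠ 0)
    (hζ : IsPrimitiveRoot ζ k) (j : ℤ) {r : ℕ} (hr : r ∈ Finset.range k) (μ : Circle) :
    frame k ζ U j μ * proj k ζ U (j - r) = piece k ζ U (j - r) μ := by
  rw [frame, Finset.sum_mul, Finset.sum_eq_single_of_mem r hr fun s hs hsr => ?_]
  · exact hU.piece_mul_proj_self hk hζ _ _
  · exact hU.piece_mul_proj hk hζ (not_dvd_of_mem_range hs hr hsr.symm) μ

theorem IsSymmetricLoop.frame_one (hU : IsSymmetricLoop ζ U) (hk : k ≠ 0)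
    (hζ : IsPrimitiveRoot ζ k) (j : ℤ) : frame k ζ U j 1 = 1 :=
  hU.sum_proj hk hζ j

/-- With $x^k=\mu$ one has $R_a^*R_b=x^{a-b}P_a^*P_b$, so the cross terms vanish and the diagonal
ones sum to the identity. -/
theorem IsSymmetricLoop.frame_mem_unitary (hU : IsSymmetricLoop ζ U) (hk : k ≠ 0)
    (hζ : IsPrimitiveRoot ζ k) (j : ℤ) (μ : Circle) :
    frame k ζ U j μ ∈ Matrix.unitaryGroup (Fin n) ℂ := by
  rw [Matrix.mem_unitaryGroup_iff']
  have h1 : ∀ a b : ℤ, star (piece k ζ U a μ) * piece k ζ U b μ =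
      ((circleRoot k μ ^ (a - b) : Circle) : ℂ) • (star (proj k ζ U a) * proj k ζ U b) := by
    intro a b
    conv_lhs => rw [← circleRoot_pow hk μ]
    rw [hU.piece_pow hk hζ, hU.piece_pow hk hζ, star_smul, star_mul, Complex.star_def,
      circle_conj_zpow, Matrix.smul_mul, Matrix.mul_smul, smul_smul, ← Circle.coe_mul, ← zpow_add,
      neg_neg, ← sub_eq_add_neg, mul_assoc, ← mul_assoc (star (U _)),
      Matrix.mem_unitaryGroup_iff'.1 (hU.mem_unitary _), one_mul]
  simp only [frame, star_sum, Finset.sum_mul, Finset.mul_sum, h1]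
  rw [← hU.sum_proj hk hζ j]
  refine Finset.sum_congr rfl fun r hr => ?_
  rw [Finset.sum_eq_single_of_mem r hr fun s hs hsr => ?_]
  · rw [sub_self, zpow_zero, Circle.coe_one, one_smul, hU.star_proj_mul_self hk hζ,
      hU.star_proj hk hζ]
  · rw [hU.star_proj_mul_proj hk hζ, smul_zero]
    simpa using not_dvd_of_mem_range (a := j) hs hr hsr.symm

/-- The two sums share all but their end terms, $R_{j+1}$ and $R_{j+1-k}=\mu R_{j+1}$. -/
theorem frame_add_one (hk : k ≠ 0) (hζ : IsPrimitiveRoot ζ k)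
    (U : Circle → Matrix (Fin n) (Fin n) ℂ) (j : ℤ) (μ : Circle) :
    frame k ζ U (j + 1) μ - frame k ζ U j μ = (1 - (μ : ℂ)) • piece k ζ U (j + 1) μ := by
  have h := Finset.sum_range_succ (fun r : ℕ => piece k ζ U (j + 1 - r) μ) k
  rw [Finset.sum_range_succ'] at h
  have h2 : ∀ r : ℕ, j + 1 - ((r + 1 : ℕ) : ℤ) = j - r := fun r => by push_cast; ring
  simp only [h2, Nat.cast_zero, sub_zero, piece_sub_period hk hζ] at h
  rw [frame, frame, sub_smul, one_smul]
  rw [sub_eq_sub_iff_add_eq_add, add_comm _ (∑ r ∈ Finset.range k, piece k ζ U (j - r) μ), h]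

theorem frame_add_period (hk : k ≠ 0) (hζ : IsPrimitiveRoot ζ k)
    (U : Circle → Matrix (Fin n) (Fin n) ℂ) (j : ℤ) (μ : Circle) :
    frame k ζ U (j + k) μ = ((μ⁻¹ : Circle) : ℂ) • frame k ζ U j μ := by
  rw [frame, frame, Finset.smul_sum]
  refine Finset.sum_congr rfl fun r _ => ?_
  rw [← piece_add_period hk hζ, sub_add_eq_add_sub]

/-! ### The components of a symmetric subspace -/

theorem integral_eq_integral_pow (hk : 2 ≤ k) {G : Circle → ℂ}
    (hG : AEStronglyMeasurable G arcMeasure) :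
    ∫ l, G l ∂arcMeasure = ∫ l : Circle, G (l ^ k) ∂arcMeasure := by
  have hmp := measurePreserving_circle_pow hk
  conv_lhs => rw [← hmp.map_eq]
  exact integral_map hmp.measurable.aemeasurable (hmp.map_eq.symm ▸ hG)

/-- Pull the integral back along the measure-preserving map $\lambda\mapsto\lambda^k$. The `k`
summands of the mean then contribute equally, because $f(\lambda^k)$ is invariant under rotation by
`ζ`. -/
theorem pairing_piece (hk : 2 ≤ k) (hζ : IsPrimitiveRoot ζ k) (hU : Continuous U) (a : ℤ)
    (c : EuclideanSpace ℂ (Fin n)) (f : L2 n) :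
    pairing (piece k ζ U a) c f =
      pairing (fun l => ((l ^ (-a) : Circle) : ℂ) • U l) c (powComp n hk f) := by
  have hk0 : k ≠ 0 := by lia
  have hA : Continuous fun l : Circle => ((l ^ (-a) : Circle) : ℂ) • U l :=
    (continuous_coe_zpow _).smul hU
  have hAi : ∀ i : ℕ, Continuous fun l : Circle =>
      (((ζ ^ i * l) ^ (-a) : Circle) : ℂ) • U (ζ ^ i * l) :=
    fun i => hA.comp (continuous_const_mul (ζ ^ i))
  have h1 : pairing (piece k ζ U a) c f =
      pairing (fun l => piece k ζ U a (l ^ k)) c (powComp n hk f) := by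
    unfold pairing
    rw [integral_eq_integral_pow hk
      (integrable_pairing (continuous_piece hk0 hζ hU a) c f).aestronglyMeasurable]
    refine integral_congr_ae ?_
    filter_upwards [coeFn_powComp hk f] with l hl
    rw [hl]
  have h2 : ∀ i : ℕ, pairing (fun l : Circle =>
      (((ζ ^ i * l) ^ (-a) : Circle) : ℂ) • U (ζ ^ i * l)) c (powComp n hk f) =
      pairing (fun l => ((l ^ (-a) : Circle) : ℂ) • U l) c (powComp n hk f) := by
    intro i
    unfold pairing
    rw [← integral_mul_left_eq_self (fun l : Circle =>
      (inner ℂ (Matrix.toEuclideanLin (((l ^ (-a) : Circle) : ℂ) • U l) c)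
        (powComp n hk f l) : ℂ)) (ζ ^ i)]
    refine integral_congr_ae ?_
    filter_upwards [coeFn_powComp hk f, (measurePreserving_mul_left arcMeasure
      (ζ ^ i)).quasiMeasurePreserving.ae (coeFn_powComp hk f)] with l hl hl2
    rw [hl, hl2, mul_pow, ← pow_mul, mul_comm i k, pow_mul, hζ.pow_eq_one, one_pow, one_mul]
  rw [h1]
  simp only [piece_eq hk0 hζ U a rfl]
  rw [pairing_const_smul, pairing_sum _ hAi]
  simp only [h2, Finset.sum_const, Finset.card_range, nsmul_eq_mul]
  have : (k : ℂ) ≠ 0 := Nat.cast_ne_zero.2 hk0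
  simp [this]

theorem pairing_zpow_frame (hk : k ≠ 0) (hζ : IsPrimitiveRoot ζ k) (hU : Continuous U) (j q : ℤ)
    (c : EuclideanSpace ℂ (Fin n)) (f : L2 n) :
    pairing (fun l => ((l ^ q : Circle) : ℂ) • frame k ζ U j l) c f =
      ∑ r ∈ Finset.range k, pairing (piece k ζ U (j - r - k * q)) c f := by
  rw [← pairing_sum _ fun r => continuous_piece hk hζ hU _]
  simp only [frame, Finset.smul_sum, piece_sub_mul_period hk hζ]

/-- Up to constant right factors, the test functions $\mu^m\Psi_jc$ with $m<0$ and the columns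
$R_ac$ with $a>j$ span the same space. This description makes the dependence on `j` transparent. -/
theorem IsSymmetricLoop.mem_mulHardy_frame_iff (hU : IsSymmetricLoop ζ U) (hk : k ≠ 0)
    (hζ : IsPrimitiveRoot ζ k) (j : ℤ) (f : L2 n) :
    f ∈ mulHardy (frame k ζ U j) ↔ ∀ a, j < a → ∀ c, pairing (piece k ζ U a) c f = 0 := by
  rw [mem_mulHardy_iff (continuous_frame hk hζ hU.continuous j) (hU.frame_mem_unitary hk hζ j)]
  have hk' : (0 : ℤ) < k := by lia
  constructor
  · intro h a ha c
    -- Division with remainder $j-a=r+kq$ has $q<0$ since $a>j$, and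
    -- $R_a=\mu^qR_{j-r}=\mu^q\Psi_jP_{j-r}$.
    let r : ℕ := ((j - a) % k).toNat
    have hr : (r : ℤ) = (j - a) % k :=
      Int.toNat_of_nonneg (Int.emod_nonneg _ hk'.ne')
    have hrk : r ∈ Finset.range k := by
      rw [Finset.mem_range]
      have := Int.emod_lt_of_pos (j - a) hk'
      lia
    let q : ℤ := (j - a) / k
    have hq : q < 0 := Int.ediv_neg_of_neg_of_pos (by lia) hk'
    have ha' : a = j - r - k * q := by
      have := Int.emod_add_mul_ediv (j - a) k
      simp only [q, hr]
      lia
    have h0 := h q hq (Matrix.toEuclideanLin (proj k ζ U (j - r)) c)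
    rw [← pairing_mul_const] at h0
    simp only [Matrix.smul_mul, hU.frame_mul_proj hk hζ j hrk, ← piece_sub_mul_period hk hζ,
      ← ha'] at h0
    exact h0
  · intro h m hm c
    rw [pairing_zpow_frame hk hζ hU.continuous]
    refine Finset.sum_eq_zero fun r hr => h _ ?_ c
    rw [Finset.mem_range] at hr
    nlinarith

theorem component_eq_mulHardy_frame (hU : IsSymmetricLoop ζ U) (hk : 2 ≤ k)
    (hζ : IsPrimitiveRoot ζ k) (j : ℕ) :
    component hk ζ (mulHardy U) j = mulHardy (frame k ζ U j) := by
  have hk0 : k ≠ 0 := by lia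
  ext f
  rw [hU.mem_mulHardy_frame_iff hk0 hζ]
  -- The eigenvalue condition holds for every function $\lambda^jf(\lambda^k)$, so only membership
  -- in $UH_+$ has to be tested.
  have heig : (shift n ^ j) (powComp n hk f) ∈
      Module.End.eigenspace (rotate n ζ) ((ζ : ℂ) ^ j) := by
    rw [Module.End.mem_eigenspace_iff]
    have hg : (shift n ^ j) (powComp n hk f) =ᵐ[arcMeasure]
        fun l => ((l ^ (j : ℤ) : Circle) : ℂ) • f (l ^ k) := by
      filter_upwards [coeFn_shift_pow j (powComp n hk f), coeFn_powComp hk f] with l h1 h2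
      rw [h1, h2]
    refine Lp.ext ?_
    filter_upwards [coeFn_rotate ζ ((shift n ^ j) (powComp n hk f)), hg,
      (measurePreserving_mul_left arcMeasure ζ).quasiMeasurePreserving.ae hg,
      Lp.coeFn_smul ((ζ : ℂ) ^ j) ((shift n ^ j) (powComp n hk f))] with l h1 h2 h3 h4
    rw [h1, h3, h4, Pi.smul_apply, h2, smul_smul, mul_pow, hζ.pow_eq_one, one_mul, mul_zpow,
      zpow_natCast ζ, Circle.coe_mul, Circle.coe_pow]
  have hmem : f ∈ component hk ζ (mulHardy U) j ↔
      (shift n ^ j) (powComp n hk f) ∈ mulHardy U := by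
    simp only [component, eigenPart, Submodule.mem_comap, Submodule.mem_inf, LinearMap.comp_apply]
    exact and_iff_left heig
  rw [hmem, mem_mulHardy_iff hU.continuous hU.mem_unitary]
  have hpair : ∀ (m : ℤ) c, pairing (fun l => ((l ^ m : Circle) : ℂ) • U l) c
      ((shift n ^ j) (powComp n hk f)) = pairing (piece k ζ U (j - m)) c f := by
    intro m c
    rw [pairing_piece hk hζ hU.continuous]
    refine integral_congr_ae ?_
    filter_upwards [coeFn_shift_pow j (powComp n hk f)] with l h1
    simp only [h1, inner_smul_right, map_smul, LinearMap.smul_apply, inner_smul_left,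
      circle_conj_zpow]
    rw [← mul_assoc, ← Circle.coe_mul, ← zpow_add, neg_neg, ← sub_eq_add_neg]
  simp only [hpair]
  constructor
  · intro h a ha c
    have := h (j - a) (by lia) c
    rwa [sub_sub_cancel] at this
  · intro h m hm c
    exact h _ (by lia) c

end ExtSol

end

noncomputable section

namespace ExtSol

/-! ### Differentiating families of loops -/

open Filter Topology

/-- There is an angle function on the circle which is smooth at `x₀`. -/
theorem exists_local_lift (x₀ : Circle) : ∃ θ : Circle → ℝ, (∀ x, Circle.exp (θ x) = x) ∧
    ContMDiffAt (𝓡 1) 𝓘(ℝ, ℝ) ∞ θ x₀ := by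
  have : Fact (Module.finrank ℝ ℂ = 1 + 1) := finrank_real_complex_fact'
  have hcoe : ContMDiff (𝓡 1) 𝓘(ℝ, ℂ) ∞ (fun x : Circle => (x : ℂ)) :=
    contMDiff_coe_sphere (E := ℂ)
  refine ⟨fun x => (Complex.log ((x : ℂ) * ((x₀⁻¹ : Circle) : ℂ))).im + Complex.arg x₀,
    fun x => ?_, ?_⟩
  · rw [Circle.exp_add, Circle.exp_arg, Complex.log_im, ← Circle.coe_mul, Circle.exp_arg,
      inv_mul_cancel_right]
  · have h1 : ContDiffAt ℝ ∞ (fun z : ℂ => (Complex.log (z * ((x₀⁻¹ : Circle) : ℂ))).im +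
        Complex.arg x₀) (x₀ : ℂ) := by
      have hl : ContDiffAt ℝ ∞ Complex.log ((x₀ : ℂ) * ((x₀⁻¹ : Circle) : ℂ)) := by
        rw [← Circle.coe_mul, mul_inv_cancel, Circle.coe_one]
        exact (Complex.contDiffAt_log (by simp)).restrict_scalars ℝ
      have hm : ContDiffAt ℝ ∞ (fun z : ℂ => z * ((x₀⁻¹ : Circle) : ℂ)) (x₀ : ℂ) := by fun_prop
      have := (Complex.imCLM.contDiff.contDiffAt.comp _ hl).comp (x₀ : ℂ) hm
      exact this.add contDiffAt_const
    exact h1.contMDiffAt.comp x₀ (hcoe x₀)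

/-- Continuity on `S¹ × X` may be tested after pulling back along `t ↦ exp(it)`. -/
theorem continuousAt_of_circleExp {X Y : Type*} [TopologicalSpace X] [TopologicalSpace Y]
    {H : Circle × X → Y} {x : X} (h : ∀ t : ℝ, ContinuousAt (fun q : ℝ × X => H (Circle.exp q.1, q.2)) (t, x))
    (l : Circle) : ContinuousAt H (l, x) := by
  obtain ⟨θ, hθ, hs⟩ := exists_local_lift l
  have h1 : ContinuousAt (fun q : Circle × X => (θ q.1, q.2)) (l, x) :=
    (hs.continuousAt.comp (x := ((l, x) : Circle × X)) continuousAt_fst).prodMk continuousAt_snd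
  have h2 := ContinuousAt.comp (x := ((l, x) : Circle × X)) (h (θ l)) h1
  have : ((fun q : ℝ × X => H (Circle.exp q.1, q.2)) ∘ fun q : Circle × X => (θ q.1, q.2)) = H := by
    funext q
    simp only [Function.comp, hθ]
  rwa [this] at h2

section Parametric

variable {E : Type*} [NormedAddCommGroup E] [NormedSpace ℝ E] {G : Circle → ℂ → E} {T : Set ℂ}

theorem hasFDerivAt_of_lift {t : ℝ} {w : ℂ}
    (h : ContDiffAt ℝ ∞ (fun q : ℝ × ℂ => G (Circle.exp q.1) q.2) (t, w)) :
    HasFDerivAt (G (Circle.exp t)) ((fderiv ℝ (fun q : ℝ × ℂ => G (Circle.exp q.1) q.2) (t, w)).comp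
      (ContinuousLinearMap.inr ℝ ℝ ℂ)) w :=
  (h.differentiableAt (by simp)).hasFDerivAt.comp w (hasFDerivAt_prodMk_right t w)

theorem differentiableAt_of_lift {w : ℂ}
    (h : ∀ t : ℝ, ContDiffAt ℝ ∞ (fun q : ℝ × ℂ => G (Circle.exp q.1) q.2) (t, w)) (l : Circle) :
    DifferentiableAt ℝ (G l) w := by
  rw [← Circle.exp_arg l]
  exact (hasFDerivAt_of_lift (h _)).differentiableAt

theorem continuousAt_fderiv_of_lift (hT : IsOpen T)
    (h : ∀ t : ℝ, ∀ w ∈ T, ContDiffAt ℝ ∞ (fun q : ℝ × ℂ => G (Circle.exp q.1) q.2) (t, w))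
    {w : ℂ} (hw : w ∈ T) (l : Circle) :
    ContinuousAt (fun q : Circle × ℂ => fderiv ℝ (G q.1) q.2) (l, w) := by
  refine continuousAt_of_circleExp (fun t => ?_) l
  have h1 : ContinuousAt (fderiv ℝ (fun q : ℝ × ℂ => G (Circle.exp q.1) q.2)) (t, w) :=
    ((h t w hw).fderiv_right (m := 0) (by simp)).continuousAt
  have h2 : ContinuousAt (fun q => (fderiv ℝ (fun q : ℝ × ℂ => G (Circle.exp q.1) q.2) q).comp
      (ContinuousLinearMap.inr ℝ ℝ ℂ)) (t, w) := h1.clm_comp continuousAt_const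
  refine h2.congr ?_
  filter_upwards [(hT.preimage continuous_snd).mem_nhds (show ((t, w) : ℝ × ℂ).2 ∈ T from hw)]
    with q hq
  exact (hasFDerivAt_of_lift (h q.1 q.2 hq)).fderiv.symm

/-- A smooth family of `E`-valued functions on the circle is differentiable in the uniform norm. -/
theorem hasFDerivAt_continuousMap (hT : IsOpen T)
    (h : ∀ t : ℝ, ∀ w ∈ T, ContDiffAt ℝ ∞ (fun q : ℝ × ℂ => G (Circle.exp q.1) q.2) (t, w))
    (hG : ∀ w, Continuous fun l => G l w) {w : ℂ} (hw : w ∈ T) :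
    ∃ L : ℂ →L[ℝ] C(Circle, E), HasFDerivAt (fun w => (⟨fun l => G l w, hG w⟩ : C(Circle, E))) L w ∧
      ∀ v l, L v l = fderiv ℝ (G l) w v := by
  have hD := fun w (hw : w ∈ T) l => continuousAt_fderiv_of_lift hT h hw l
  have hDl : Continuous fun l => fderiv ℝ (G l) w :=
    continuous_iff_continuousAt.2 fun l => ContinuousAt.comp
      (f := fun l : Circle => ((l, w) : Circle × ℂ)) (hD w hw l) (by fun_prop)
  let L₀ : ℂ →ₗ[ℝ] C(Circle, E) :=
    { toFun := fun v => ⟨fun l => fderiv ℝ (G l) w v, hDl.clm_apply continuous_const⟩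
      map_add' := fun v v' => by ext l; simp
      map_smul' := fun a v => by
        ext l
        exact map_smul (fderiv ℝ (G l) w) a v }
  refine ⟨LinearMap.toContinuousLinearMap L₀, ?_, fun v l => rfl⟩
  rw [hasFDerivAt_iff_isLittleO, Asymptotics.isLittleO_iff]
  intro ε hε
  -- Compactness of the circle makes the derivatives close uniformly in `l`; the mean value
  -- inequality on a ball then gives the uniform estimate.
  have hev : ∀ᶠ w' in 𝓝 w, ∀ l ∈ (Set.univ : Set Circle),
      ‖fderiv ℝ (G l) w' - fderiv ℝ (G l) w‖ < ε := by
    refine isCompact_univ.eventually_forall_of_forall_eventually fun l _ => ?_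
    have hs : ContinuousAt (fun q : Circle × ℂ => ‖fderiv ℝ (G q.1) q.2 - fderiv ℝ (G q.1) w‖)
        (l, w) := ((hD w hw l).sub (hDl.comp continuous_fst).continuousAt).norm
    have hsw : ContinuousAt (fun q : ℂ × Circle => ((q.2, q.1) : Circle × ℂ)) (w, l) := by fun_prop
    have := ContinuousAt.comp (x := ((w, l) : ℂ × Circle)) hs hsw
    exact this.eventually_lt continuousAt_const (by simpa using hε)
  obtain ⟨δ, hδ, hball⟩ := Metric.eventually_nhds_iff_ball.1 (hev.and (hT.mem_nhds hw))
  filter_upwards [Metric.ball_mem_nhds w hδ] with w' hw'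
  rw [ContinuousMap.norm_le _ (by positivity)]
  intro l
  refine Convex.norm_image_sub_le_of_norm_hasFDerivWithin_le' (f := G l)
    (f' := fun w => fderiv ℝ (G l) w) (φ := fderiv ℝ (G l) w) (s := Metric.ball w δ)
    (fun x hx => ?_) (fun x hx => ((hball x hx).1 l trivial).le) (convex_ball w δ)
    (Metric.mem_ball_self hδ) hw'
  exact (differentiableAt_of_lift (fun t => h t x (hball x hx).2) l).hasFDerivAt.hasFDerivWithinAt

end Parametric

/-! ### Smooth matrix families on the surface, read in charts -/

section Surface

variable {M : Type*} [TopologicalSpace M] [ChartedSpace ℂ M] {n : ℕ}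

/-- Smoothness of a matrix-valued function on `S¹ × M`. -/
def IsSmoothFamily (F : Circle → M → Matrix (Fin n) (Fin n) ℂ) : Prop :=
  ∀ i j : Fin n, ContMDiff ((𝓡 1).prod 𝓘(ℝ, ℂ)) 𝓘(ℝ, ℂ) ∞ (fun q : Circle × M => F q.1 q.2 i j)

/-- The differential at `p`, in the coordinate `e`, of a matrix-valued function. -/
def coordDeriv (F : M → Matrix (Fin n) (Fin n) ℂ) (e : OpenPartialHomeomorph M ℂ) (p : M) (v : ℂ) :
    Matrix (Fin n) (Fin n) ℂ :=
  Matrix.of fun i j => fderiv ℝ (fun w : ℂ => F (e.symm w) i j) (e p) v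

theorem contMDiffAt_real_of_complex {e : OpenPartialHomeomorph M ℂ} [IsManifold 𝓘(ℂ) ω M]
    (he : e ∈ IsManifold.maximalAtlas 𝓘(ℂ) ω M) {w : ℂ} (hw : w ∈ e.target) :
    ContMDiffAt 𝓘(ℝ, ℂ) 𝓘(ℝ, ℂ) ∞ e.symm w := by
  have h := (contMDiffOn_symm_of_mem_maximalAtlas he).contMDiffAt (e.open_target.mem_nhds hw)
  rw [contMDiffAt_iff] at h ⊢
  refine ⟨h.1, ?_⟩
  have h2 := h.2.restrict_scalars ℝ
  exact h2.of_le le_top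

theorem IsSmoothFamily.continuous_loop {F : Circle → M → Matrix (Fin n) (Fin n) ℂ}
    (hF : IsSmoothFamily F) (p : M) : Continuous fun l => F l p :=
  continuous_matrix fun i j => (hF i j).continuous.comp (by fun_prop : Continuous fun l => (l, p))

variable {F : Circle → M → Matrix (Fin n) (Fin n) ℂ}

/-- The homogeneous pieces of a smooth family are smooth. -/
theorem IsSmoothFamily.piece {k : ℕ} (hk : k ≠ 0) {ζ : Circle} (hζ : IsPrimitiveRoot ζ k)
    (hF : IsSmoothFamily F) (a : ℤ) :
    IsSmoothFamily fun μ p => piece k ζ (fun l => F l p) a μ := by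
  rintro i j ⟨μ₀, p₀⟩
  obtain ⟨θ, hθ, hs⟩ := exists_local_lift μ₀
  have hroot : ∀ μ, Circle.exp (θ μ / k) ^ k = μ := fun μ => by
    rw [← Circle.exp_natCast_mul, mul_div_cancel₀ _ (Nat.cast_ne_zero.2 hk), hθ]
  -- Angles of the `k` roots of `μ`, smooth near `μ₀`; through them the mean becomes a finite sum of
  -- smooth functions.
  let τ : ℕ → Circle → ℝ := fun r μ => r * Complex.arg ζ + θ μ / k
  have hτ : ∀ r μ, ζ ^ r * Circle.exp (θ μ / k) = Circle.exp (τ r μ) := fun r μ => by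
    rw [Circle.exp_add, Circle.exp_natCast_mul, Circle.exp_arg]
  have heq : (fun q : Circle × M => ExtSol.piece k ζ (fun l => F l q.2) a q.1 i j) = fun q =>
      (k : ℂ)⁻¹ * ∑ r ∈ Finset.range k,
        Complex.exp (((-a : ℤ) : ℂ) * τ r q.1 * Complex.I) * F (Circle.exp (τ r q.1)) q.2 i j := by
    funext q
    rw [piece_eq hk hζ _ a (hroot q.1)]
    simp only [hτ, Matrix.smul_apply, Matrix.sum_apply, smul_eq_mul]
    congr 1
    refine Finset.sum_congr rfl fun r _ => ?_
    rw [← Circle.exp_intCast_mul, Circle.coe_exp]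
    push_cast
    rfl
  rw [heq]
  have hτs : ∀ r, ContMDiffAt ((𝓡 1).prod 𝓘(ℝ, ℂ)) 𝓘(ℝ, ℝ) ∞ (fun q : Circle × M => τ r q.1)
      (μ₀, p₀) := by
    intro r
    have h0 : ContDiff ℝ ∞ fun x : ℝ => r * Complex.arg ζ + x / k := by fun_prop
    exact ContMDiffAt.comp (μ₀, p₀) (g := fun x : ℝ => r * Complex.arg ζ + x / k)
      h0.contMDiff.contMDiffAt
      (ContMDiffAt.comp (μ₀, p₀) (g := θ) hs contMDiffAt_fst)
  have hterm : ∀ r, ContMDiffAt ((𝓡 1).prod 𝓘(ℝ, ℂ)) 𝓘(ℝ, ℂ) ∞ (fun q : Circle × M =>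
      Complex.exp (((-a : ℤ) : ℂ) * τ r q.1 * Complex.I) * F (Circle.exp (τ r q.1)) q.2 i j)
      (μ₀, p₀) := by
    intro r
    have he : ContDiff ℝ ∞ fun x : ℝ => Complex.exp (((-a : ℤ) : ℂ) * x * Complex.I) := by
      have : ContDiff ℝ ∞ fun x : ℝ => (x : ℂ) := Complex.ofRealCLM.contDiff
      fun_prop
    have h1 : ContMDiffAt ((𝓡 1).prod 𝓘(ℝ, ℂ)) 𝓘(ℝ, ℂ) ∞ (fun q : Circle × M =>
        Complex.exp (((-a : ℤ) : ℂ) * τ r q.1 * Complex.I)) (μ₀, p₀) :=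
      ContMDiffAt.comp (μ₀, p₀)
        (g := fun x : ℝ => Complex.exp (((-a : ℤ) : ℂ) * x * Complex.I)) he.contMDiff.contMDiffAt (hτs r)
    have h2 : ContMDiffAt ((𝓡 1).prod 𝓘(ℝ, ℂ)) (𝓡 1) ∞ (fun q : Circle × M =>
        Circle.exp (τ r q.1)) (μ₀, p₀) :=
      ContMDiffAt.comp (μ₀, p₀) contMDiff_circleExp.contMDiffAt (hτs r)
    have h3 := ContMDiffAt.comp (μ₀, p₀) ((hF i j) _) (h2.prodMk contMDiffAt_snd)
    exact ContMDiffAt.comp (μ₀, p₀) (g := fun z : ℂ × ℂ => z.1 * z.2)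
      contDiff_mul.contMDiff.contMDiffAt (h1.prodMk_space h3)
  have hsum := contMDiffAt_finsetSum (t := Finset.range k) fun r _ => hterm r
  have hc : ContDiff ℝ ∞ fun z : ℂ => (k : ℂ)⁻¹ * z := by fun_prop
  exact ContMDiffAt.comp (μ₀, p₀) hc.contMDiff.contMDiffAt hsum

theorem IsSmoothFamily.frame {k : ℕ} (hk : k ≠ 0) {ζ : Circle} (hζ : IsPrimitiveRoot ζ k)
    (hF : IsSmoothFamily F) (j : ℤ) :
    IsSmoothFamily fun μ p => frame k ζ (fun l => F l p) j μ := by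
  intro i i'
  simp only [ExtSol.frame, Matrix.sum_apply]
  exact contMDiff_finsetSum fun r _ => hF.piece hk hζ (j - r) i i'

variable [IsManifold 𝓘(ℂ) ω M] {e : OpenPartialHomeomorph M ℂ}

theorem IsSmoothFamily.contDiffAt_lift (hF : IsSmoothFamily F)
    (he : e ∈ IsManifold.maximalAtlas 𝓘(ℂ) ω M) (i j : Fin n) (t : ℝ) {w : ℂ} (hw : w ∈ e.target) :
    ContDiffAt ℝ ∞ (fun q : ℝ × ℂ => F (Circle.exp q.1) (e.symm q.2) i j) (t, w) := by
  rw [← contMDiffAt_iff_contDiffAt]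
  have h1 : ContMDiffAt 𝓘(ℝ, ℝ × ℂ) (𝓡 1) ∞ (fun q : ℝ × ℂ => Circle.exp q.1) (t, w) :=
    (contMDiff_circleExp.comp contDiff_fst.contMDiff).contMDiffAt
  have h2 : ContMDiffAt 𝓘(ℝ, ℝ × ℂ) 𝓘(ℝ, ℂ) ∞ (fun q : ℝ × ℂ => e.symm q.2) (t, w) :=
    ContMDiffAt.comp (t, w) (g := e.symm) (contMDiffAt_real_of_complex he hw)
      contDiff_snd.contMDiff.contMDiffAt
  exact ContMDiffAt.comp (t, w) ((hF i j) _) (h1.prodMk h2)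

theorem IsSmoothFamily.differentiableAt (hF : IsSmoothFamily F)
    (he : e ∈ IsManifold.maximalAtlas 𝓘(ℂ) ω M) (l : Circle) (i j : Fin n) {p : M}
    (hp : p ∈ e.source) : DifferentiableAt ℝ (fun w => F l (e.symm w) i j) (e p) :=
  differentiableAt_of_lift (G := fun l w => F l (e.symm w) i j)
    (fun t => hF.contDiffAt_lift he i j t (e.map_source hp)) l

theorem IsSmoothFamily.continuous_coordDeriv (hF : IsSmoothFamily F)
    (he : e ∈ IsManifold.maximalAtlas 𝓘(ℂ) ω M) {p : M} (hp : p ∈ e.source) (v : ℂ) :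
    Continuous fun l => coordDeriv (F l) e p v := by
  refine continuous_matrix fun i j => continuous_iff_continuousAt.2 fun l => ?_
  have h := continuousAt_fderiv_of_lift (G := fun l w => F l (e.symm w) i j) e.open_target
    (fun t w hw => hF.contDiffAt_lift he i j t hw) (e.map_source hp) l
  exact (ContinuousAt.comp (f := fun l : Circle => ((l, e p) : Circle × ℂ)) h
    (by fun_prop)).clm_apply continuousAt_const

theorem toEuclideanLin_apply_coord (A : Matrix (Fin n) (Fin n) ℂ) (c : EuclideanSpace ℂ (Fin n))
    (i : Fin n) : Matrix.toEuclideanLin A c i = ∑ j, A i j * c j := by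
  simp [Matrix.toLpLin_apply, Matrix.mulVec, dotProduct]

/-- `p ↦ F(·, p) c` is differentiable as an `L²`-valued map, with the pointwise derivative. -/
theorem IsSmoothFamily.exists_hasFDerivAt (hF : IsSmoothFamily F)
    (he : e ∈ IsManifold.maximalAtlas 𝓘(ℂ) ω M) {p : M} (hp : p ∈ e.source)
    (c : EuclideanSpace ℂ (Fin n)) :
    ∃ L : ℂ →L[ℝ] L2 n,
      HasFDerivAt (fun w => ofContinuous n (column (fun l => F l (e.symm w))
        (hF.continuous_loop _) c)) L (e p) ∧
      ∀ v, L v = ofContinuous n (column (fun l => coordDeriv (F l) e p v)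
        (hF.continuous_coordDeriv he hp v) c) := by
  let G : Circle → ℂ → EuclideanSpace ℂ (Fin n) := fun l w =>
    Matrix.toEuclideanLin (F l (e.symm w)) c
  have hG : ∀ t : ℝ, ∀ w ∈ e.target,
      ContDiffAt ℝ ∞ (fun q : ℝ × ℂ => G (Circle.exp q.1) q.2) (t, w) := by
    intro t w hw
    rw [contDiffAt_piLp]
    intro i
    simp only [G, toEuclideanLin_apply_coord]
    exact ContDiffAt.sum fun j _ => (hF.contDiffAt_lift he i j t hw).mul contDiffAt_const
  obtain ⟨L, hL, hLv⟩ := hasFDerivAt_continuousMap e.open_target hG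
    (fun w => continuous_toEuclideanLin (hF.continuous_loop _) continuous_const) (e.map_source hp)
  -- Differentiability in the uniform norm passes to $L^2$ through the bounded inclusion of
  -- continuous functions.
  refine ⟨((ofContinuous n).restrictScalars ℝ).comp L,
    ((ofContinuous n).restrictScalars ℝ).hasFDerivAt.comp (e p) hL, fun v => ?_⟩
  change ofContinuous n (L v) = _
  congr 1
  ext l i
  rw [hLv]
  change _ = Matrix.toEuclideanLin (coordDeriv (F l) e p v) c i
  rw [toEuclideanLin_apply_coord]
  have h1 : HasFDerivAt (fun w => G l w i)
      (((EuclideanSpace.proj (𝕜 := ℂ) i).restrictScalars ℝ).comp (fderiv ℝ (G l) (e p))) (e p) :=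
    ((EuclideanSpace.proj (𝕜 := ℂ) i : EuclideanSpace ℂ (Fin n) →L[ℂ] ℂ).restrictScalars ℝ).hasFDerivAt.comp
      (e p) (differentiableAt_of_lift (fun t => hG t _ (e.map_source hp)) l).hasFDerivAt
  have h2 : HasFDerivAt (fun w => G l w i) (∑ j, (c j) •
      fderiv ℝ (fun w => F l (e.symm w) i j) (e p)) (e p) := by
    simp only [G, toEuclideanLin_apply_coord]
    exact HasFDerivAt.fun_sum fun j _ => (hF.differentiableAt he l i j hp).hasFDerivAt.mul_const (c j)
  have := DFunLike.congr_fun (h1.unique h2) v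
  refine Eq.trans this ?_
  simp only [sum_apply, smul_apply, smul_eq_mul]
  exact Finset.sum_congr rfl fun j _ => mul_comm _ _

end Surface

end ExtSol

end

noncomputable section

namespace ExtSol

/-! ### Calculus of coordinate derivatives of matrix functions -/

section Surface

variable {M : Type*} [TopologicalSpace M] {n : ℕ}
  {e : OpenPartialHomeomorph M ℂ} {p : M}

theorem coordDeriv_sum_smul {ι : Type*} (s : Finset ι) (b : ι → ℂ)
    {F : ι → M → Matrix (Fin n) (Fin n) ℂ}
    (hF : ∀ r i j, DifferentiableAt ℝ (fun w => F r (e.symm w) i j) (e p)) (v : ℂ) :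
    coordDeriv (fun q => ∑ r ∈ s, b r • F r q) e p v = ∑ r ∈ s, b r • coordDeriv (F r) e p v := by
  ext i j
  simp only [coordDeriv, Matrix.of_apply, Matrix.sum_apply, Matrix.smul_apply, smul_eq_mul]
  rw [(HasFDerivAt.fun_sum fun r _ => (hF r i j).hasFDerivAt.const_mul (b r)).fderiv]
  simp

theorem coordDeriv_const_smul (b : ℂ) {F : M → Matrix (Fin n) (Fin n) ℂ}
    (hF : ∀ i j, DifferentiableAt ℝ (fun w => F (e.symm w) i j) (e p)) (v : ℂ) :
    coordDeriv (fun q => b • F q) e p v = b • coordDeriv F e p v := by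
  simpa using coordDeriv_sum_smul {()} (fun _ => b) (fun _ => hF) v

theorem coordDeriv_sub {F G : M → Matrix (Fin n) (Fin n) ℂ}
    (hF : ∀ i j, DifferentiableAt ℝ (fun w => F (e.symm w) i j) (e p))
    (hG : ∀ i j, DifferentiableAt ℝ (fun w => G (e.symm w) i j) (e p)) (v : ℂ) :
    coordDeriv (fun q => F q - G q) e p v = coordDeriv F e p v - coordDeriv G e p v := by
  ext i j
  simp only [coordDeriv, Matrix.of_apply, Matrix.sub_apply]
  rw [((hF i j).hasFDerivAt.fun_sub (hG i j).hasFDerivAt).fderiv]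
  simp

theorem coordDeriv_eq_re_im (F : M → Matrix (Fin n) (Fin n) ℂ) (v : ℂ) :
    coordDeriv F e p v = (v.re : ℂ) • coordDeriv F e p 1 + (v.im : ℂ) • coordDeriv F e p Complex.I := by
  ext i j
  simp only [coordDeriv, Matrix.of_apply, Matrix.add_apply, Matrix.smul_apply, smul_eq_mul]
  set L := fderiv ℝ (fun w => F (e.symm w) i j) (e p)
  have : v = v.re • (1 : ℂ) + v.im • Complex.I := by
    rw [Complex.real_smul, Complex.real_smul, mul_one, Complex.re_add_im]
  conv_lhs => rw [this, map_add, map_smul, map_smul]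
  rw [Complex.real_smul, Complex.real_smul]

/-- The logarithmic differential of a unitary matrix function is skew-Hermitian. -/
theorem star_coordDeriv_mul_add {F : M → Matrix (Fin n) (Fin n) ℂ}
    (hF : ∀ i j, DifferentiableAt ℝ (fun w => F (e.symm w) i j) (e p))
    (hu : ∀ q, star (F q) * F q = 1) (hp : p ∈ e.source) (v : ℂ) :
    star (coordDeriv F e p v) * F p + star (F p) * coordDeriv F e p v = 0 := by
  ext i j
  have h1 : HasFDerivAt (fun w => ∑ r, starRingEnd ℂ (F (e.symm w) r i) * F (e.symm w) r j) _ (e p) :=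
    HasFDerivAt.fun_sum fun r _ =>
      (Complex.conjCLE.toContinuousLinearMap.hasFDerivAt.comp (e p) (hF r i).hasFDerivAt).mul
        (hF r j).hasFDerivAt
  have h2 : (fun w => ∑ r, starRingEnd ℂ (F (e.symm w) r i) * F (e.symm w) r j) =
      fun _ => (1 : Matrix (Fin n) (Fin n) ℂ) i j := by
    funext w
    rw [← hu (e.symm w), Matrix.mul_apply]
    rfl
  rw [h2] at h1
  have h3 := DFunLike.congr_fun (h1.unique (hasFDerivAt_const _ _)) v
  simp only [e.left_inv hp, sum_apply, add_apply,
    smul_apply, ContinuousLinearMap.comp_apply,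
    zero_apply, smul_eq_mul, Finset.sum_add_distrib] at h3
  simp only [Matrix.add_apply, Matrix.mul_apply, Matrix.star_apply, Matrix.zero_apply, coordDeriv,
    Matrix.of_apply]
  rw [← h3, add_comm]
  congr 1
  · refine Finset.sum_congr rfl fun r _ => ?_
    simp only [Function.comp, e.left_inv hp]
    rfl
  · refine Finset.sum_congr rfl fun r _ => ?_
    rw [mul_comm]
    rfl

/-- The `∂_z`-derivative, in the coordinate `e`, of a matrix-valued function. -/
def coordDz (F : M → Matrix (Fin n) (Fin n) ℂ) (e : OpenPartialHomeomorph M ℂ) (p : M) :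
    Matrix (Fin n) (Fin n) ℂ :=
  (1 / 2 : ℂ) • (coordDeriv F e p 1 - Complex.I • coordDeriv F e p Complex.I)

theorem coordDz_sum_smul {ι : Type*} (s : Finset ι) (b : ι → ℂ)
    {F : ι → M → Matrix (Fin n) (Fin n) ℂ}
    (hF : ∀ r i j, DifferentiableAt ℝ (fun w => F r (e.symm w) i j) (e p)) :
    coordDz (fun q => ∑ r ∈ s, b r • F r q) e p = ∑ r ∈ s, b r • coordDz (F r) e p := by
  simp only [coordDz, coordDeriv_sum_smul s b hF, Finset.smul_sum, ← Finset.sum_sub_distrib]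
  refine Finset.sum_congr rfl fun r _ => ?_
  module

theorem coordDz_const_smul (b : ℂ) {F : M → Matrix (Fin n) (Fin n) ℂ}
    (hF : ∀ i j, DifferentiableAt ℝ (fun w => F (e.symm w) i j) (e p)) :
    coordDz (fun q => b • F q) e p = b • coordDz F e p := by
  simp only [coordDz, coordDeriv_const_smul b hF]
  module

theorem coordDz_sub {F G : M → Matrix (Fin n) (Fin n) ℂ}
    (hF : ∀ i j, DifferentiableAt ℝ (fun w => F (e.symm w) i j) (e p))
    (hG : ∀ i j, DifferentiableAt ℝ (fun w => G (e.symm w) i j) (e p)) :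
    coordDz (fun q => F q - G q) e p = coordDz F e p - coordDz G e p := by
  simp only [coordDz, coordDeriv_sub hF hG]
  module

theorem coordDz_of_eqn {F : M → Matrix (Fin n) (Fin n) ℂ} {a b : ℂ}
    {A B : Matrix (Fin n) (Fin n) ℂ}
    (h : ∀ v, coordDeriv F e p v = F p * ((a * v) • A + (b * starRingEnd ℂ v) • B)) :
    coordDz F e p = a • (F p * A) := by
  rw [coordDz, h, h, map_one, Complex.conj_I, Matrix.mul_add, Matrix.mul_add, Matrix.mul_smul,
    Matrix.mul_smul, Matrix.mul_smul, Matrix.mul_smul]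
  have hI : Complex.I * Complex.I = -1 := Complex.I_mul_I
  match_scalars
  · linear_combination (-1 / 2 * a) * hI
  · linear_combination (1 / 2 * b) * hI

/-- For unitary `F`, the equation for `∂_z` determines the whole differential. -/
theorem coordDeriv_of_coordDz {F : M → Matrix (Fin n) (Fin n) ℂ}
    (hF : ∀ i j, DifferentiableAt ℝ (fun w => F (e.symm w) i j) (e p))
    (hu : ∀ q, F q ∈ Matrix.unitaryGroup (Fin n) ℂ) (hp : p ∈ e.source) {l : Circle}
    {A : Matrix (Fin n) (Fin n) ℂ} (h : coordDz F e p = (1 - (l : ℂ)⁻¹) • (F p * A)) (v : ℂ) :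
    star (F p) * coordDeriv F e p v =
      ((1 - (l : ℂ)⁻¹) * v) • A + ((1 - (l : ℂ)) * starRingEnd ℂ v) • (-star A) := by
  set X := star (F p) * coordDeriv F e p 1
  set Y := star (F p) * coordDeriv F e p Complex.I
  have hskew : ∀ v, star (star (F p) * coordDeriv F e p v) = -(star (F p) * coordDeriv F e p v) := by
    intro v
    rw [star_mul, star_star]
    exact eq_neg_of_add_eq_zero_left
      (star_coordDeriv_mul_add hF (fun q => Matrix.mem_unitaryGroup_iff'.1 (hu q)) hp v)
  have hX : star X = -X := hskew 1
  have hY : star Y = -Y := hskew Complex.I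
  have hZ : (1 / 2 : ℂ) • (X - Complex.I • Y) = (1 - (l : ℂ)⁻¹) • A := by
    have := congrArg (star (F p) * ·) h
    simp only [coordDz, Matrix.mul_smul, Matrix.mul_sub, ← mul_assoc,
      Matrix.mem_unitaryGroup_iff'.1 (hu p), one_mul] at this
    exact this
  -- The adjoint of the $\partial_z$ equation is minus the $\partial_{\bar z}$ equation, as `X` and
  -- `Y` are skew-Hermitian and $\overline{\lambda^{-1}}=\lambda$ on the circle.
  have hZs : (1 / 2 : ℂ) • (-X - Complex.I • Y) = (1 - (l : ℂ)) • star A := by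
    have := congrArg star hZ
    rw [star_smul, star_smul, star_sub, star_smul, hX, hY] at this
    simp only [Complex.star_def, map_sub, map_one, map_inv₀, map_div₀, map_ofNat,
      Complex.conj_I, ← Circle.coe_inv_eq_conj, Circle.coe_inv, inv_inv, smul_neg, neg_smul,
      neg_neg] at this
    exact this
  have hv : star (F p) * coordDeriv F e p v = (v.re : ℂ) • X + (v.im : ℂ) • Y := by
    rw [coordDeriv_eq_re_im, Matrix.mul_add, Matrix.mul_smul, Matrix.mul_smul]
  have hre : (v.re : ℂ) = (v + starRingEnd ℂ v) / 2 := by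
    rw [Complex.add_conj]; push_cast; ring
  have him : (v.im : ℂ) = -Complex.I * (v - starRingEnd ℂ v) / 2 := by
    rw [Complex.sub_conj]
    push_cast
    linear_combination (v.im : ℂ) * Complex.I_mul_I
  rw [hv, mul_comm _ v, mul_comm _ (starRingEnd ℂ v), mul_smul, mul_smul, smul_neg, ← hZ, ← hZs,
    hre, him]
  module

end Surface

end ExtSol

end

noncomputable section

namespace ExtSol

/-! ### Derivatives of the pieces and frames of an extended solution -/

variable {n k : ℕ} {ζ : Circle}

theorem IsSymmetricLoop.frame_mul_proj_self {U : Circle → Matrix (Fin n) (Fin n) ℂ}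
    (hU : IsSymmetricLoop ζ U) (hk : k ≠ 0) (hζ : IsPrimitiveRoot ζ k) (j : ℤ) (μ : Circle) :
    frame k ζ U j μ * proj k ζ U j = piece k ζ U j μ := by
  simpa using hU.frame_mul_proj hk hζ j (Finset.mem_range.2 (Nat.pos_of_ne_zero hk)) μ

/-- Modulo `k`, the index $j+1$ is the last one in the frame, $j-(k-1)$; passing to it by a period
costs the factor `μ`. -/
theorem IsSymmetricLoop.frame_mul_proj_succ {U : Circle → Matrix (Fin n) (Fin n) ℂ}
    (hU : IsSymmetricLoop ζ U) (hk : k ≠ 0) (hζ : IsPrimitiveRoot ζ k) (j : ℤ) (μ : Circle) :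
    frame k ζ U j μ * proj k ζ U (j + 1) = (μ : ℂ) • piece k ζ U (j + 1) μ := by
  have h := hU.frame_mul_proj hk hζ j (r := k - 1) (by rw [Finset.mem_range]; lia) μ
  have h1 : j - ((k - 1 : ℕ) : ℤ) = j + 1 - k := by lia
  rw [h1, piece_sub_period hk hζ, ← proj_add_period hk hζ, sub_add_cancel] at h
  exact h

section Surface

variable {M : Type*} [TopologicalSpace M] [ChartedSpace ℂ M] [IsManifold 𝓘(ℂ) ω M]
  {e : OpenPartialHomeomorph M ℂ} {p : M} {F : Circle → M → Matrix (Fin n) (Fin n) ℂ}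

/-- In the mean defining $R_a$, the factors $1-y^{-1}$ and $1-y$ turn $y^{-a}$ into differences with
exponents $-(a+1)$ and $-(a-1)$. -/
theorem coordDeriv_piece (hF : IsSmoothFamily F) (he : e ∈ IsManifold.maximalAtlas 𝓘(ℂ) ω M)
    (hp : p ∈ e.source) {A B : Matrix (Fin n) (Fin n) ℂ}
    (h : ∀ (l : Circle) (v : ℂ), coordDeriv (F l) e p v =
      F l p * (((1 - (l : ℂ)⁻¹) * v) • A + ((1 - (l : ℂ)) * starRingEnd ℂ v) • B))
    (a : ℤ) (μ : Circle) (v : ℂ) :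
    coordDeriv (fun q => piece k ζ (fun l => F l q) a μ) e p v =
      v • ((piece k ζ (fun l => F l p) a μ - piece k ζ (fun l => F l p) (a + 1) μ) * A) +
      starRingEnd ℂ v •
        ((piece k ζ (fun l => F l p) a μ - piece k ζ (fun l => F l p) (a - 1) μ) * B) := by
  have hd := fun l i j => hF.differentiableAt he l i j hp
  unfold piece
  set x := circleRoot k μ
  have hd' : ∀ i j, DifferentiableAt ℝ (fun w => (∑ r ∈ Finset.range k,
      (((ζ ^ r * x) ^ (-a) : Circle) : ℂ) • F (ζ ^ r * x) (e.symm w)) i j) (e p) := by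
    intro i j
    simp only [Matrix.sum_apply, Matrix.smul_apply, smul_eq_mul]
    exact DifferentiableAt.fun_sum fun r _ => (hd _ i j).const_mul _
  rw [coordDeriv_const_smul (F := fun q => ∑ r ∈ Finset.range k,
      (((ζ ^ r * x) ^ (-a) : Circle) : ℂ) • F (ζ ^ r * x) q) _ hd',
    coordDeriv_sum_smul _ _ fun r => hd (ζ ^ r * x)]
  simp only [h]
  rw [← smul_sub, ← Finset.sum_sub_distrib, Matrix.smul_mul, Finset.sum_mul, smul_comm v,
    Finset.smul_sum (r := v), ← smul_sub, ← Finset.sum_sub_distrib, Matrix.smul_mul,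
    Finset.sum_mul, smul_comm (starRingEnd ℂ v), Finset.smul_sum (r := starRingEnd ℂ v),
    ← smul_add, ← Finset.sum_add_distrib]
  congr 1
  refine Finset.sum_congr rfl fun r _ => ?_
  set y := ζ ^ r * x
  have h1 : ((y ^ (-(a + 1)) : Circle) : ℂ) = ((y ^ (-a) : Circle) : ℂ) * (y : ℂ)⁻¹ := by
    rw [← Circle.coe_inv, ← Circle.coe_mul, neg_add, ← sub_eq_add_neg, zpow_sub_one]
  have h2 : ((y ^ (-(a - 1)) : Circle) : ℂ) = ((y ^ (-a) : Circle) : ℂ) * (y : ℂ) := by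
    rw [← Circle.coe_mul, neg_sub, sub_eq_neg_add, zpow_add_one]
  rw [h1, h2, Matrix.mul_add, Matrix.mul_smul, Matrix.mul_smul, Matrix.sub_mul, Matrix.sub_mul,
    Matrix.smul_mul, Matrix.smul_mul, Matrix.smul_mul, Matrix.smul_mul]
  module

/-- The differences of pieces telescope to $\Psi_j-\Psi_{j+1}=-(1-\mu)R_{j+1}$ and
$\Psi_j-\Psi_{j-1}=(1-\mu)R_j$. Substituting $\mu R_{j+1}=\Psi_jP_{j+1}$ and $R_j=\Psi_jP_j$
restores the factors $1-\mu^{-1}$ and $1-\mu$. -/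
theorem coordDeriv_frame (hk : k ≠ 0) (hζ : IsPrimitiveRoot ζ k) (hF : IsSmoothFamily F)
    (hS : ∀ q, IsSymmetricLoop ζ fun l => F l q) (he : e ∈ IsManifold.maximalAtlas 𝓘(ℂ) ω M)
    (hp : p ∈ e.source) {A B : Matrix (Fin n) (Fin n) ℂ}
    (h : ∀ (l : Circle) (v : ℂ), coordDeriv (F l) e p v =
      F l p * (((1 - (l : ℂ)⁻¹) * v) • A + ((1 - (l : ℂ)) * starRingEnd ℂ v) • B))
    (j : ℤ) (μ : Circle) (v : ℂ) :
    coordDeriv (fun q => frame k ζ (fun l => F l q) j μ) e p v =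
      frame k ζ (fun l => F l p) j μ *
        (((1 - (μ : ℂ)⁻¹) * v) • (proj k ζ (fun l => F l p) (j + 1) * A) +
          ((1 - (μ : ℂ)) * starRingEnd ℂ v) • (proj k ζ (fun l => F l p) j * B)) := by
  have hd : ∀ (r : ℕ) (i i' : Fin n), DifferentiableAt ℝ
      (fun w => piece k ζ (fun l => F l (e.symm w)) (j - r) μ i i') (e p) :=
    fun r i i' => (hF.piece hk hζ (j - r)).differentiableAt he μ i i' hp
  have h1 := coordDeriv_sum_smul (Finset.range k) (fun _ => (1 : ℂ))
    (F := fun r q => piece k ζ (fun l => F l q) (j - (r : ℕ)) μ) hd v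
  simp only [one_smul] at h1
  have h2 : ∑ r ∈ Finset.range k, (piece k ζ (fun l => F l p) (j - r) μ -
      piece k ζ (fun l => F l p) (j - r + 1) μ) =
      -((1 - (μ : ℂ)) • piece k ζ (fun l => F l p) (j + 1) μ) := by
    rw [← frame_add_one hk hζ, neg_sub, frame, frame, Finset.sum_sub_distrib]
    simp only [sub_add_eq_add_sub]
  have h3 : ∑ r ∈ Finset.range k, (piece k ζ (fun l => F l p) (j - r) μ -
      piece k ζ (fun l => F l p) (j - r - 1) μ) =
      (1 - (μ : ℂ)) • piece k ζ (fun l => F l p) j μ := by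
    have := frame_add_one hk hζ (fun l => F l p) (j - 1) μ
    rw [sub_add_cancel] at this
    rw [← this, frame, frame, Finset.sum_sub_distrib]
    simp only [sub_right_comm]
  have hμ : (μ : ℂ) * (μ : ℂ)⁻¹ = 1 := mul_inv_cancel₀ (Circle.coe_ne_zero μ)
  calc _ = _ := h1
    _ = v • ((-((1 - (μ : ℂ)) • piece k ζ (fun l => F l p) (j + 1) μ)) * A) +
        starRingEnd ℂ v • (((1 - (μ : ℂ)) • piece k ζ (fun l => F l p) j μ) * B) := by
      rw [← h2, ← h3]
      simp only [coordDeriv_piece hF he hp h, Finset.sum_add_distrib, ← Finset.smul_sum,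
        Finset.sum_mul]
    _ = _ := by
      rw [Matrix.mul_add, Matrix.mul_smul, Matrix.mul_smul, ← mul_assoc, ← mul_assoc,
        (hS p).frame_mul_proj_succ hk hζ, (hS p).frame_mul_proj_self hk hζ, neg_mul,
        Matrix.smul_mul, Matrix.smul_mul, Matrix.smul_mul]
      match_scalars
      · linear_combination v * hμ
      · ring

/-- If a differentiable section takes values in `{f | ∀ a > j, ⟨R_a c, f⟩ = 0}`, then its
`z`-derivative takes values in the corresponding space for `j + 1`. -/
theorem pairing_piece_dz_eq_zero (hk : k ≠ 0) (hζ : IsPrimitiveRoot ζ k) (hF : IsSmoothFamily F)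
    (hS : ∀ q, IsSymmetricLoop ζ fun l => F l q) (he : e ∈ IsManifold.maximalAtlas 𝓘(ℂ) ω M)
    (hp : p ∈ e.source) {A B : Matrix (Fin n) (Fin n) ℂ}
    (h : ∀ (l : Circle) (v : ℂ), coordDeriv (F l) e p v =
      F l p * (((1 - (l : ℂ)⁻¹) * v) • A + ((1 - (l : ℂ)) * starRingEnd ℂ v) • B))
    {j : ℤ} {s : M → L2 n}
    (hs : ∀ q ∈ e.source, s q ∈ mulHardy (frame k ζ (fun l => F l q) j))
    (hsd : DifferentiableOn ℝ (s ∘ e.symm) e.target) {a : ℤ} (ha : j + 1 < a)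
    (c : EuclideanSpace ℂ (Fin n)) :
    pairing (piece k ζ (fun l => F l p) a) c (dz (s ∘ e.symm) (e p)) = 0 := by
  have hzero : ∀ q ∈ e.source, ∀ b, j < b → ∀ c,
      pairing (piece k ζ (fun l => F l q) b) c (s q) = 0 := fun q hq =>
    ((hS q).mem_mulHardy_frame_iff hk hζ j (s q)).1 (hs q hq)
  have hpc := fun b => continuous_piece hk hζ (hS p).continuous b
  obtain ⟨L, hL, hLv⟩ := (hF.piece hk hζ a).exists_hasFDerivAt he hp c
  have hs' := (hsd.differentiableAt (e.open_target.mem_nhds (e.map_source hp))).hasFDerivAt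
  -- Differentiate $\langle R_ac,s\rangle=0$ by the product rule; it remains to kill the term in
  -- which $R_a$ is differentiated.
  have hin := hL.inner ℂ hs'
  have hconst : HasFDerivAt (fun w => inner ℂ (ofContinuous n (column
      (fun μ => piece k ζ (fun l => F l (e.symm w)) a μ)
      ((hF.piece hk hζ a).continuous_loop _) c)) ((s ∘ e.symm) w)) (0 : ℂ →L[ℝ] ℂ) (e p) := by
    refine (hasFDerivAt_const (0 : ℂ) (e p)).congr_of_eventuallyEq ?_
    filter_upwards [e.open_target.mem_nhds (e.map_source hp)] with w hw
    rw [← pairing_eq_inner]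
    exact hzero _ (e.map_target hw) a (by lia) c
  have hv : ∀ v, pairing (piece k ζ (fun l => F l p) a) c
      (fderiv ℝ (s ∘ e.symm) (e p) v) = 0 := by
    intro v
    have h0 := DFunLike.congr_fun (hin.unique hconst) v
    simp only [ContinuousLinearMap.comp_apply, ContinuousLinearMap.prod_apply,
      fderivInnerCLM_apply, Function.comp, e.left_inv hp, zero_apply, hLv,
      ← pairing_eq_inner] at h0
    have hpd : pairing (fun μ => coordDeriv (fun q => piece k ζ (fun l => F l q) a μ) e p v) c
        (s p) = 0 := by
      simp only [coordDeriv_piece hF he hp h, ← Matrix.smul_mul]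
      have e1 : ∀ b (z : ℂ) (C : Matrix (Fin n) (Fin n) ℂ), Continuous fun μ =>
          (z • (piece k ζ (fun l => F l p) a μ - piece k ζ (fun l => F l p) b μ)) * C := fun b z C =>
        (((hpc a).sub (hpc b)).const_smul z).mul continuous_const
      -- Applied with $b=a\pm1$; the case $b=a-1$ is what requires $a>j+1$.
      have e2 : ∀ b, j < b → ∀ (z : ℂ) (C : Matrix (Fin n) (Fin n) ℂ), pairing (fun μ =>
          (z • (piece k ζ (fun l => F l p) a μ - piece k ζ (fun l => F l p) b μ)) * C) c (s p)
          = 0 := fun b hb z C => by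
        rw [pairing_mul_const, pairing_const_smul, pairing_sub (hpc a) (hpc b),
          hzero p hp a (by lia), hzero p hp b hb, sub_zero, mul_zero]
      have := pairing_sum (Finset.univ : Finset Bool) (A := fun i μ => bif i then
        (v • (piece k ζ (fun l => F l p) a μ - piece k ζ (fun l => F l p) (a + 1) μ)) * A else
        (starRingEnd ℂ v • (piece k ζ (fun l => F l p) a μ -
          piece k ζ (fun l => F l p) (a - 1) μ)) * B) (by rintro (_ | _) <;> exact e1 _ _ _) c (s p)
      simp only [Fintype.sum_bool, cond_true, cond_false] at this
      rw [this, e2 _ (by lia), e2 _ (by lia), add_zero]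
    rw [hpd, add_zero] at h0
    exact h0
  rw [pairing_eq_inner (hpc a)] at *
  simp only [pairing_eq_inner (hpc a)] at hv
  rw [dz, inner_smul_right, inner_sub_right, inner_smul_right, hv, hv, mul_zero, sub_zero,
    mul_zero]

end Surface

end ExtSol

end

noncomputable section

namespace ExtSol

/-! ### From extended solutions to cyclic superhorizontal sequences -/

variable {n k : ℕ} {ζ : Circle}

section Surface

variable {M : Type*} [TopologicalSpace M] [ChartedSpace ℂ M]
  {e : OpenPartialHomeomorph M ℂ} {p : M} {F : Circle → M → Matrix (Fin n) (Fin n) ℂ}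

theorem IsExtendedSolution.exists_coordDeriv_eq {Φ : Circle → M → Matrix.unitaryGroup (Fin n) ℂ}
    (hΦ : IsExtendedSolution Φ) (hF : ∀ l q, (Φ l q : Matrix (Fin n) (Fin n) ℂ) = F l q)
    (he : e ∈ IsManifold.maximalAtlas 𝓘(ℂ) ω M) :
    ∃ A B : M → Matrix (Fin n) (Fin n) ℂ, ∀ p ∈ e.source, ∀ (l : Circle) (v : ℂ),
      coordDeriv (F l) e p v =
        F l p * (((1 - (l : ℂ)⁻¹) * v) • A p + ((1 - (l : ℂ)) * starRingEnd ℂ v) • B p) := by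
  obtain ⟨A, B, h⟩ := hΦ.eqn e he
  refine ⟨A, B, fun p hp l v => ?_⟩
  rw [← h l p hp v, ← mul_assoc, ← hF]
  have h1 : (Φ l p : Matrix (Fin n) (Fin n) ℂ) *
      (((Φ l p)⁻¹ : Matrix.unitaryGroup (Fin n) ℂ) : Matrix (Fin n) (Fin n) ℂ) = 1 := by
    rw [← Submonoid.coe_mul, mul_inv_cancel, Submonoid.coe_one]
  rw [h1, one_mul]
  simp only [coordDeriv, coordDifferential, hF]

/-- If `U H₊` is an extended solution, where `U` is unitary and based at `1`, then so is `U`. -/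
theorem IsExtendedSolutionFamily.exists_eq {V : M → Submodule ℂ (L2 n)}
    (hV : IsExtendedSolutionFamily V) (hVF : ∀ q, V q = mulHardy fun l => F l q)
    (hc : ∀ q, Continuous fun l => F l q) (hu : ∀ l q, F l q ∈ Matrix.unitaryGroup (Fin n) ℂ)
    (h1 : ∀ q, F 1 q = 1) :
    ∃ Φ : Circle → M → Matrix.unitaryGroup (Fin n) ℂ, IsExtendedSolution Φ ∧
      ∀ l q, (Φ l q : Matrix (Fin n) (Fin n) ℂ) = F l q := by
  obtain ⟨Φ, hΦ, h⟩ := hV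
  refine ⟨Φ, hΦ, fun l q => ?_⟩
  have hsm : IsSmoothFamily fun l q => (Φ l q : Matrix (Fin n) (Fin n) ℂ) := hΦ.smooth
  exact congrFun (eq_of_mulHardy_eq (hsm.continuous_loop q) (fun l => (Φ l q).2) (hc q)
    (fun l => hu l q) (by rw [hΦ.map_one]; rfl) (h1 q) ((h q).symm.trans (hVF q))) l

/-- The adjoint of the shift multiplies $R_a$ by $\mu^{-1}$, raising its index by `k`. The cyclic
condition thus has the same form as superhorizontality at $j=k-1$. -/
theorem mem_mulHardy_frame_zero_iff_shift {U : Circle → Matrix (Fin n) (Fin n) ℂ}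
    (hU : IsSymmetricLoop ζ U) (hk : k ≠ 0) (hζ : IsPrimitiveRoot ζ k) (f : L2 n) :
    shift n f ∈ mulHardy (frame k ζ U (0 : ℕ)) ↔
      ∀ a, (k : ℤ) < a → ∀ c, pairing (piece k ζ U a) c f = 0 := by
  rw [hU.mem_mulHardy_frame_iff hk hζ]
  have h : ∀ a c, pairing (piece k ζ U a) c (shift n f) = pairing (piece k ζ U (a + k)) c f := by
    intro a c
    rw [pairing_shift]
    simp only [← piece_add_period hk hζ]
  simp only [h, Nat.cast_zero]
  constructor
  · intro h a ha c
    have := h (a - k) (by lia) c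
    rwa [sub_add_cancel] at this
  · intro h a ha c
    exact h _ (by lia) c

variable [IsManifold 𝓘(ℂ) ω M]

theorem isExtendedSolutionFamily_frame (hk : k ≠ 0) (hζ : IsPrimitiveRoot ζ k)
    (hF : IsSmoothFamily F) (hS : ∀ q, IsSymmetricLoop ζ fun l => F l q)
    (h : ∀ e ∈ IsManifold.maximalAtlas 𝓘(ℂ) ω M,
      ∃ A B : M → Matrix (Fin n) (Fin n) ℂ, ∀ p ∈ e.source, ∀ (l : Circle) (v : ℂ),
        coordDeriv (F l) e p v =
          F l p * (((1 - (l : ℂ)⁻¹) * v) • A p + ((1 - (l : ℂ)) * starRingEnd ℂ v) • B p))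
    (j : ℤ) : IsExtendedSolutionFamily fun q => mulHardy (frame k ζ (fun l => F l q) j) := by
  refine ⟨fun μ q => ⟨frame k ζ (fun l => F l q) j μ, (hS q).frame_mem_unitary hk hζ j μ⟩,
    ⟨hF.frame hk hζ j, fun q => Subtype.ext ((hS q).frame_one hk hζ j), fun e he => ?_⟩,
    fun q => rfl⟩
  obtain ⟨A, B, hAB⟩ := h e he
  refine ⟨fun p => proj k ζ (fun l => F l p) (j + 1) * A p,
    fun p => proj k ζ (fun l => F l p) j * B p, fun μ p hp v => ?_⟩
  have := coordDeriv_frame hk hζ hF hS he hp (hAB p hp) j μ v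
  change star (frame k ζ (fun l => F l p) j μ) *
    coordDeriv (fun q => frame k ζ (fun l => F l q) j μ) e p v = _
  rw [this, ← mul_assoc, Matrix.mem_unitaryGroup_iff'.1 ((hS p).frame_mem_unitary hk hζ j μ),
    one_mul]

theorem isCyclicSuperhorizontal_frame (hk : 2 ≤ k) (hζ : IsPrimitiveRoot ζ k)
    (hF : IsSmoothFamily F) (hS : ∀ q, IsSymmetricLoop ζ fun l => F l q)
    (h : ∀ e ∈ IsManifold.maximalAtlas 𝓘(ℂ) ω M,
      ∃ A B : M → Matrix (Fin n) (Fin n) ℂ, ∀ p ∈ e.source, ∀ (l : Circle) (v : ℂ),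
        coordDeriv (F l) e p v =
          F l p * (((1 - (l : ℂ)⁻¹) * v) • A p + ((1 - (l : ℂ)) * starRingEnd ℂ v) • B p)) :
    IsCyclicSuperhorizontal k fun (j : ℕ) q => mulHardy (frame k ζ (fun l => F l q) j) := by
  have hk0 : k ≠ 0 := by lia
  refine ⟨fun j _ q f hf => ?_, fun j _ => isExtendedSolutionFamily_frame hk0 hζ hF hS h j,
    fun j _ e he s hs hsd p hp => ?_, fun e he s hs hsd p hp => ?_⟩
  · rw [(hS q).mem_mulHardy_frame_iff hk0 hζ] at hf ⊢
    exact fun a ha c => hf a (by push_cast at ha; lia) c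
  · obtain ⟨A, B, hAB⟩ := h e he
    rw [LinearMap.id_apply, (hS p).mem_mulHardy_frame_iff hk0 hζ]
    exact fun a ha c => pairing_piece_dz_eq_zero hk0 hζ hF hS he hp (hAB p hp) hs hsd
      (by push_cast at ha; exact ha) c
  · obtain ⟨A, B, hAB⟩ := h e he
    rw [mem_mulHardy_frame_zero_iff_shift (hS p) hk0 hζ]
    exact fun a ha c => pairing_piece_dz_eq_zero hk0 hζ hF hS he hp (hAB p hp) hs hsd (by lia) c

/-! ### From cyclic superhorizontal sequences back to the extended solution -/

/-- The superhorizontality conditions, tested on the sections `Ψ_j c`. -/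
theorem IsCyclicSuperhorizontal.pairing_column_coordDz (hk : 2 ≤ k) (hζ : IsPrimitiveRoot ζ k)
    (hF : IsSmoothFamily F) (hS : ∀ q, IsSymmetricLoop ζ fun l => F l q)
    (h : IsCyclicSuperhorizontal k fun (j : ℕ) q => mulHardy (frame k ζ (fun l => F l q) j))
    (he : e ∈ IsManifold.maximalAtlas 𝓘(ℂ) ω M) (hp : p ∈ e.source) {j : ℕ} (hj : j < k) {a : ℤ}
    (ha : (j : ℤ) + 1 < a) (c d : EuclideanSpace ℂ (Fin n)) :
    ∫ μ : Circle, (inner ℂ (Matrix.toEuclideanLin (piece k ζ (fun l => F l p) a μ) d)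
      (Matrix.toEuclideanLin (coordDz (fun q => frame k ζ (fun l => F l q) j μ) e p) c) : ℂ)
      ∂arcMeasure = 0 := by
  have hk0 : k ≠ 0 := by lia
  have hΨ : IsSmoothFamily fun μ q => frame k ζ (fun l => F l q) j μ := hF.frame hk0 hζ j
  let s : M → L2 n := fun q => ofContinuous n (column _ (hΨ.continuous_loop q) c)
  have hs : ∀ q ∈ e.source, s q ∈ mulHardy (frame k ζ (fun l => F l q) j) := fun q _ =>
    column_mem_mulHardy _ ((hS q).frame_mem_unitary hk0 hζ j) c
  have hsd : DifferentiableOn ℝ (s ∘ e.symm) e.target := by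
    intro w hw
    obtain ⟨L, hL, -⟩ := hΨ.exists_hasFDerivAt he (e.map_target hw) c
    rw [e.right_inv hw] at hL
    exact hL.differentiableAt.differentiableWithinAt
  have hpair : pairing (piece k ζ (fun l => F l p) a) d (dz (s ∘ e.symm) (e p)) = 0 := by
    rcases Nat.lt_or_ge (j + 1) k with hj1 | hj1
    · have := h.superhorizontal j hj1 e he s hs hsd p hp
      rw [LinearMap.id_apply, (hS p).mem_mulHardy_frame_iff hk0 hζ] at this
      exact this a (by push_cast; exact ha) d
    · obtain rfl : j = k - 1 := by lia
      have := h.cyclic e he s hs hsd p hp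
      rw [mem_mulHardy_frame_zero_iff_shift (hS p) hk0 hζ] at this
      exact this a (by lia) d
  rw [← hpair]
  obtain ⟨L, hL, hLv⟩ := hΨ.exists_hasFDerivAt he hp c
  have hdz : dz (s ∘ e.symm) (e p) = (1 / 2 : ℂ) • (L 1 - Complex.I • L Complex.I) := by
    rw [dz, show fderiv ℝ (s ∘ e.symm) (e p) = L from hL.fderiv]
  have hae : dz (s ∘ e.symm) (e p) =ᵐ[arcMeasure] fun μ =>
      Matrix.toEuclideanLin (coordDz (fun q => frame k ζ (fun l => F l q) j μ) e p) c := by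
    rw [hdz, hLv, hLv]
    set X := ofContinuous n (column _ (hΨ.continuous_coordDeriv he hp 1) c) with hX
    set Y := ofContinuous n (column _ (hΨ.continuous_coordDeriv he hp Complex.I) c) with hY
    filter_upwards [Lp.coeFn_smul (1 / 2 : ℂ) (X - Complex.I • Y),
      Lp.coeFn_sub X (Complex.I • Y), Lp.coeFn_smul Complex.I Y,
      coeFn_ofContinuous (column _ (hΨ.continuous_coordDeriv he hp 1) c),
      coeFn_ofContinuous (column _ (hΨ.continuous_coordDeriv he hp Complex.I) c)]
      with μ h1 h2 h3 h4 h5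
    rw [h1, Pi.smul_apply, h2, Pi.sub_apply, h3, Pi.smul_apply, hX, hY, h4, h5, coordDz,
      map_smul, map_sub, map_smul]
    rfl
  refine integral_congr_ae ?_
  filter_upwards [hae] with μ hμ
  rw [hμ]

/-- Superhorizontality forces the `∂_z`-derivative of `Ψ_j` into the image of `P_{j+1}`. -/
theorem IsCyclicSuperhorizontal.proj_mul_eq (hk : 2 ≤ k) (hζ : IsPrimitiveRoot ζ k)
    (hF : IsSmoothFamily F) (hS : ∀ q, IsSymmetricLoop ζ fun l => F l q)
    (h : IsCyclicSuperhorizontal k fun (j : ℕ) q => mulHardy (frame k ζ (fun l => F l q) j))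
    (he : e ∈ IsManifold.maximalAtlas 𝓘(ℂ) ω M) (hp : p ∈ e.source) {j : ℕ} (hj : j < k)
    {A : Matrix (Fin n) (Fin n) ℂ} (hA : ∀ μ : Circle,
      coordDz (fun q => frame k ζ (fun l => F l q) j μ) e p =
        (1 - (μ : ℂ)⁻¹) • (frame k ζ (fun l => F l p) j μ * A)) :
    proj k ζ (fun l => F l p) (j + 1) * A = A := by
  have hk0 : k ≠ 0 := by lia
  have hzero : ∀ r ∈ Finset.range k, r ≠ k - 1 → proj k ζ (fun l => F l p) (j - r) * A = 0 := by
    intro r hr hrk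
    have hr' := Finset.mem_range.1 hr
    refine Matrix.toEuclideanLin.injective (LinearMap.ext fun c => ext_inner_left ℂ fun d => ?_)
    -- The index $j-r+k$ exceeds $j+1$ exactly when $r<k-1$, so every residue except that of $j+1$
    -- is excluded.
    have h0 := h.pairing_column_coordDz hk hζ hF hS he hp hj (a := j - r + k) (by lia) c d
    -- Unitarity of the frame makes the integrand a constant times $\mu-1$, whose mean is $-1$;
    -- hence the constant vanishes.
    have hint : ∀ μ : Circle, (inner ℂ
        (Matrix.toEuclideanLin (piece k ζ (fun l => F l p) (j - r + k) μ) d)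
        (Matrix.toEuclideanLin (coordDz (fun q => frame k ζ (fun l => F l q) j μ) e p) c) : ℂ) =
        ((μ : ℂ) - 1) * inner ℂ d (Matrix.toEuclideanLin (proj k ζ (fun l => F l p) (j - r) * A) c) := by
      intro μ
      have hμ : (μ : ℂ) * (μ : ℂ)⁻¹ = 1 := mul_inv_cancel₀ (Circle.coe_ne_zero μ)
      rw [hA, piece_add_period hk0 hζ, ← (hS p).frame_mul_proj hk0 hζ j hr, map_smul, map_smul,
        LinearMap.smul_apply, LinearMap.smul_apply, inner_smul_left, inner_smul_right,
        toEuclideanLin_mul, toEuclideanLin_mul,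
        inner_unitary ((hS p).frame_mem_unitary hk0 hζ j μ), inner_toEuclideanLin,
        (hS p).star_proj hk0 hζ, toEuclideanLin_mul, Circle.coe_inv_eq_conj, Complex.conj_conj]
      linear_combination (-(inner ℂ d (Matrix.toEuclideanLin (proj k ζ (fun l => F l p) (j - r))
        (Matrix.toEuclideanLin A c)))) * hμ
    have hi1 : Integrable (fun μ : Circle => (μ : ℂ)) arcMeasure :=
      (show Continuous fun μ : Circle => (μ : ℂ) from
        continuous_subtype_val).integrable_of_hasCompactSupport (HasCompactSupport.of_compactSpace _)
    have hint1 : ∫ μ : Circle, (μ : ℂ) ∂arcMeasure = 0 := by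
      simpa using integral_coe_zpow (m := 1) one_ne_zero
    simp only [hint] at h0
    rw [integral_mul_const, integral_sub hi1 (integrable_const _), hint1, integral_const,
      probReal_univ, one_smul, zero_sub, neg_one_mul, neg_eq_zero] at h0
    rw [h0, map_zero, LinearMap.zero_apply, inner_zero_right]
  have hlast : k - 1 ∈ Finset.range k := by rw [Finset.mem_range]; lia
  have hsum := (hS p).sum_proj hk0 hζ j
  have h1 := congrArg (· * A) hsum
  simp only [Finset.sum_mul, one_mul] at h1
  rw [Finset.sum_eq_single_of_mem (k - 1) hlast hzero, ← proj_add_period hk0 hζ] at h1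
  rwa [show (j : ℤ) - ((k - 1 : ℕ) : ℤ) + k = j + 1 by lia] at h1

/-- Each summand is $U(x)P_{j+1}$, and $P_1,\dots,P_k$ sum to the identity. -/
theorem eq_sum_piece {U : Circle → Matrix (Fin n) (Fin n) ℂ} (hU : IsSymmetricLoop ζ U)
    (hk : k ≠ 0) (hζ : IsPrimitiveRoot ζ k) (x : Circle) :
    U x = ∑ j ∈ Finset.range k, ((x ^ ((j : ℤ) + 1) : Circle) : ℂ) • piece k ζ U (j + 1) (x ^ k) := by
  have h : ∀ j : ℤ, ((x ^ j : Circle) : ℂ) • piece k ζ U j (x ^ k) = U x * proj k ζ U j := by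
    intro j
    rw [hU.piece_pow hk hζ, smul_smul, ← Circle.coe_mul, ← zpow_add, add_neg_cancel, zpow_zero,
      Circle.coe_one, one_smul]
  simp only [h, ← Finset.mul_sum]
  have h2 := hU.sum_proj hk hζ k
  rw [← Finset.sum_range_reflect] at h2
  have h3 : ∑ j ∈ Finset.range k, proj k ζ U ((j : ℤ) + 1) = 1 := by
    rw [← h2]
    refine Finset.sum_congr rfl fun j hj => ?_
    rw [Finset.mem_range] at hj
    congr 1
    lia
  rw [h3, mul_one]

/-- Recovering a piece from a difference of frames divides by $1-\mu$ with $\mu=x^k$; the excluded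
points are later reached by continuity. -/
theorem dense_setOf_pow_ne_one (hk : k ≠ 0) : Dense {x : Circle | x ^ k ≠ 1} := by
  have hcount : {t : ℝ | Circle.exp t ^ k = 1}.Countable := by
    refine (Set.countable_range fun m : ℤ => m * (2 * Real.pi) / k).mono fun t ht => ?_
    change Circle.exp t ^ k = 1 at ht
    rw [← Circle.exp_natCast_mul, Circle.exp_eq_one] at ht
    obtain ⟨m, hm⟩ := ht
    refine ⟨m, ?_⟩
    have : (k : ℝ) ≠ 0 := Nat.cast_ne_zero.2 hk
    simp only [← hm]
    field_simp
  have hd := hcount.dense_compl ℝ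
  have hsurj : DenseRange Circle.exp := Circle.exp_surjective.denseRange
  refine (hsurj.dense_image Circle.exp.continuous hd).mono ?_
  rintro _ ⟨t, ht, rfl⟩
  exact ht

theorem exists_coordDz_eq (hk : k ≠ 0) (hζ : IsPrimitiveRoot ζ k)
    (hF : IsSmoothFamily F) (hS : ∀ q, IsSymmetricLoop ζ fun l => F l q)
    (he : e ∈ IsManifold.maximalAtlas 𝓘(ℂ) ω M) (hp : p ∈ e.source)
    {A : ℕ → Matrix (Fin n) (Fin n) ℂ} (hA : ∀ j ≤ k, ∀ μ : Circle,
      coordDz (fun q => frame k ζ (fun l => F l q) j μ) e p =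
        (1 - (μ : ℂ)⁻¹) • (frame k ζ (fun l => F l p) j μ * A j))
    (hP : ∀ j ≤ k, proj k ζ (fun l => F l p) (j + 1) * A j = A j) (hper : A k = A 0)
    (x : Circle) :
    coordDz (F x) e p = (1 - (x : ℂ)⁻¹) • (F x p * ∑ j ∈ Finset.range k, A j) := by
  have hd := fun (a : ℤ) μ i i' => (hF.piece hk hζ a).differentiableAt he μ i i' hp
  have hdf := fun (a : ℤ) μ i i' => (hF.frame hk hζ a).differentiableAt he μ i i' hp
  have hframe : ∀ j ≤ k, ∀ μ : Circle, frame k ζ (fun l => F l p) j μ * A j =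
      (μ : ℂ) • (piece k ζ (fun l => F l p) (j + 1) μ * A j) := by
    intro j hj μ
    conv_lhs => rw [← hP j hj]
    rw [← mul_assoc, (hS p).frame_mul_proj_succ hk hζ, Matrix.smul_mul]
  -- Differentiate $(1-\mu)R_{j+1}=\Psi_{j+1}-\Psi_j$, insert $\Psi_jA_j=\Psi_jP_{j+1}A_j=\mu
  -- R_{j+1}A_j$ and its successor, and cancel $1-\mu$.
  have hpiece : ∀ j < k, ∀ μ : Circle, μ ≠ 1 →
      coordDz (fun q => piece k ζ (fun l => F l q) (j + 1) μ) e p =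
        piece k ζ (fun l => F l p) (j + 1) μ * A j -
          piece k ζ (fun l => F l p) (j + 1 + 1) μ * A (j + 1) := by
    intro j hj μ hμ
    have hne : (1 - (μ : ℂ)) ≠ 0 := sub_ne_zero.2 fun h => hμ (Circle.coe_injective h.symm)
    have hμμ : (μ : ℂ)⁻¹ * (μ : ℂ) = 1 := inv_mul_cancel₀ (Circle.coe_ne_zero μ)
    have h1 := hframe j hj.le μ
    have h2 := hframe (j + 1) hj μ
    have h3 := coordDz_const_smul (1 - (μ : ℂ))
      (F := fun q => piece k ζ (fun l => F l q) (j + 1) μ) (hd (j + 1) μ)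
    simp only [← frame_add_one hk hζ] at h3
    have h4 := hA (j + 1) hj μ
    push_cast at h2 h4
    rw [coordDz_sub (hdf (j + 1) μ) (hdf j μ), hA j hj.le, h4, h1, h2] at h3
    refine smul_right_injective _ hne ?_
    change (1 - (μ : ℂ)) • _ = (1 - (μ : ℂ)) • _
    rw [← h3]
    match_scalars
    · linear_combination -hμμ
    · linear_combination hμμ
  have hgen : ∀ x : Circle, x ^ k ≠ 1 →
      coordDz (F x) e p = (1 - (x : ℂ)⁻¹) • (F x p * ∑ j ∈ Finset.range k, A j) := by
    intro x hx
    have hsum : F x = fun q => ∑ j ∈ Finset.range k,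
        ((x ^ ((j : ℤ) + 1) : Circle) : ℂ) • piece k ζ (fun l => F l q) (j + 1) (x ^ k) :=
      funext fun q => eq_sum_piece (hS q) hk hζ x
    have hxp : ∀ (a b : ℤ), ((x ^ a : Circle) : ℂ) • piece k ζ (fun l => F l p) b (x ^ k) =
        ((x ^ (a - b) : Circle) : ℂ) • (F x p * proj k ζ (fun l => F l p) b) := by
      intro a b
      rw [(hS p).piece_pow hk hζ, smul_smul, ← Circle.coe_mul, ← zpow_add, sub_eq_add_neg]
    have hterm : ∀ j ∈ Finset.range k, ((x ^ ((j : ℤ) + 1) : Circle) : ℂ) •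
        coordDz (fun q => piece k ζ (fun l => F l q) (j + 1) (x ^ k)) e p =
        F x p * A j - (x : ℂ)⁻¹ • (F x p * A (j + 1)) := by
      intro j hj
      rw [Finset.mem_range] at hj
      have hP1 := hP (j + 1) hj
      push_cast at hP1
      rw [hpiece j hj _ hx, smul_sub, ← Matrix.smul_mul, ← Matrix.smul_mul, hxp, hxp, sub_self,
        zpow_zero, Circle.coe_one, one_smul, mul_assoc, hP j hj.le, Matrix.smul_mul, mul_assoc,
        hP1, sub_add_cancel_left, zpow_neg_one, Circle.coe_inv]
    -- Cyclicity $A_k=A_0$ gives both terms the same coefficient, producing the common factor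
    -- $1-x^{-1}$.
    have hshift : ∑ j ∈ Finset.range k, A (j + 1) = ∑ j ∈ Finset.range k, A j := by
      have := Finset.sum_range_succ A k
      rw [Finset.sum_range_succ', hper] at this
      exact add_right_cancel this
    conv_lhs => rw [hsum]
    rw [coordDz_sum_smul (Finset.range k) (fun j : ℕ => ((x ^ ((j : ℤ) + 1) : Circle) : ℂ))
      (F := fun (j : ℕ) q => piece k ζ (fun l => F l q) (j + 1) (x ^ k))
      (fun j => hd (j + 1) (x ^ k)), Finset.sum_congr rfl hterm, Finset.sum_sub_distrib,
      ← Finset.smul_sum, ← Finset.mul_sum, ← Finset.mul_sum, hshift, sub_smul, one_smul]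
  have hcl : Continuous fun x => coordDz (F x) e p := by
    have h1 := hF.continuous_coordDeriv he hp 1
    have h2 := hF.continuous_coordDeriv he hp Complex.I
    exact Continuous.const_smul (h1.sub (h2.const_smul Complex.I)) (1 / 2 : ℂ)
  have hcr : Continuous fun x : Circle => (1 - (x : ℂ)⁻¹) • (F x p * ∑ j ∈ Finset.range k, A j) := by
    have h1 : Continuous fun x : Circle => (1 - (x : ℂ)⁻¹) := by
      simp only [← Circle.coe_inv]
      exact continuous_const.sub (continuous_subtype_val.comp continuous_inv)
    exact h1.smul ((hF.continuous_loop p).mul continuous_const)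
  exact congrFun (hcl.ext_on (dense_setOf_pow_ne_one hk) hcr fun x hx => hgen x hx) x

theorem IsCyclicSuperhorizontal.exists_coordDz_eq (hk : 2 ≤ k) (hζ : IsPrimitiveRoot ζ k)
    (hF : IsSmoothFamily F) (hS : ∀ q, IsSymmetricLoop ζ fun l => F l q)
    (h : IsCyclicSuperhorizontal k fun (j : ℕ) q => mulHardy (frame k ζ (fun l => F l q) j))
    (he : e ∈ IsManifold.maximalAtlas 𝓘(ℂ) ω M) (hp : p ∈ e.source) :
    ∃ A : Matrix (Fin n) (Fin n) ℂ, ∀ x : Circle,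
      coordDz (F x) e p = (1 - (x : ℂ)⁻¹) • (F x p * A) := by
  have hk0 : k ≠ 0 := by lia
  have hex : ∀ j : ℕ, ∃ A : Matrix (Fin n) (Fin n) ℂ, j < k → ∀ μ : Circle,
      coordDz (fun q => frame k ζ (fun l => F l q) j μ) e p =
        (1 - (μ : ℂ)⁻¹) • (frame k ζ (fun l => F l p) j μ * A) := by
    intro j
    by_cases hj : j < k
    · obtain ⟨Ψ, hΨ, heq⟩ := (h.extendedSolution j hj).exists_eq
        (F := fun μ q => frame k ζ (fun l => F l q) j μ) (fun q => rfl)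
        (fun q => continuous_frame hk0 hζ (hS q).continuous j)
        (fun μ q => (hS q).frame_mem_unitary hk0 hζ j μ) (fun q => (hS q).frame_one hk0 hζ j)
      obtain ⟨A, B, hAB⟩ := hΨ.exists_coordDeriv_eq heq he
      exact ⟨A p, fun _ μ => coordDz_of_eqn (hAB p hp μ)⟩
    · exact ⟨0, fun h => absurd h hj⟩
  choose A hA using hex
  have h0k : 0 < k := by lia
  have hmod : ∀ j ≤ k, j < k ∧ j % k = j ∨ j = k ∧ j % k = 0 := by
    intro j hj
    rcases hj.lt_or_eq with hj | rfl
    · exact Or.inl ⟨hj, Nat.mod_eq_of_lt hj⟩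
    · exact Or.inr ⟨rfl, Nat.mod_self _⟩
  -- Reducing the index modulo `k` sets $A_k=A_0$; this is legitimate because
  -- $\Psi_k=\mu^{-1}\Psi_0$ satisfies the same equation as $\Psi_0$.
  refine ⟨_, ExtSol.exists_coordDz_eq hk0 hζ hF hS he hp (A := fun j => A (j % k)) ?_ ?_ (by simp)⟩
  · intro j hj μ
    rcases hmod j hj with ⟨hj, hm⟩ | ⟨rfl, hm⟩
    · simp only [hm]
      exact hA j hj μ
    · simp only [hm]
      have hfr : ∀ q, frame j ζ (fun l => F l q) j μ =
          ((μ⁻¹ : Circle) : ℂ) • frame j ζ (fun l => F l q) (0 : ℕ) μ := fun q => by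
        rw [← frame_add_period hk0 hζ, Nat.cast_zero, zero_add]
      simp only [hfr]
      rw [coordDz_const_smul _ fun i i' => (hF.frame hk0 hζ (0 : ℕ)).differentiableAt he μ i i' hp,
        hA 0 h0k μ, Matrix.smul_mul, smul_comm]
  · intro j hj
    rcases hmod j hj with ⟨hj, hm⟩ | ⟨rfl, hm⟩
    · simp only [hm]
      exact h.proj_mul_eq hk hζ hF hS he hp hj (hA j hj)
    · simp only [hm]
      have := h.proj_mul_eq hk hζ hF hS he hp h0k (hA 0 h0k)
      rw [Nat.cast_zero, ← proj_add_period hk0 hζ] at this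
      rwa [add_comm (j : ℤ) 1, ← zero_add (1 : ℤ)]

end Surface

end ExtSol

end

theorem proposition4p1 {M : Type*} [TopologicalSpace M] [ChartedSpace ℂ M]
    [IsManifold 𝓘(ℂ) ω M] (n k : ℕ) (hk : 2 ≤ k)
    (ζ : Circle) (hζ : IsPrimitiveRoot ζ k)
    (Φ : Circle → M → Matrix.unitaryGroup (Fin n) ℂ)
    (hΦ : ExtSol.IsSmoothUnitary Φ) (hΦ_one : ∀ p, Φ 1 p = 1)
    (hsymm : ∀ p, ExtSol.IsSymmetric ζ (ExtSol.grassmannian Φ p)) :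
    ExtSol.IsExtendedSolutionFamily (ExtSol.grassmannian Φ) ↔
      ExtSol.IsCyclicSuperhorizontal k
        (fun j p => ExtSol.component hk ζ (ExtSol.grassmannian Φ p) j) := by
  have hk0 : k ≠ 0 := by lia
  have hF : ExtSol.IsSmoothFamily fun l p => (Φ l p : Matrix (Fin n) (Fin n) ℂ) := hΦ
  have h1 : ∀ p, (Φ 1 p : Matrix (Fin n) (Fin n) ℂ) = 1 := fun p => by rw [hΦ_one]; rfl
  have hS : ∀ p, ExtSol.IsSymmetricLoop ζ fun l => (Φ l p : Matrix (Fin n) (Fin n) ℂ) := fun p =>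
    ⟨hF.continuous_loop p, fun l => (Φ l p).2, h1 p, ExtSol.map_mul_of_isSymmetric
      (hF.continuous_loop p) (fun l => (Φ l p).2) (h1 p) hk0 hζ.pow_eq_one (hsymm p)⟩
  have hcomp : (fun j p => ExtSol.component hk ζ (ExtSol.grassmannian Φ p) j) = fun (j : ℕ) p =>
      ExtSol.mulHardy (ExtSol.frame k ζ (fun l => (Φ l p : Matrix (Fin n) (Fin n) ℂ)) j) :=
    funext fun j => funext fun p => ExtSol.component_eq_mulHardy_frame (hS p) hk hζ j
  rw [hcomp]
  constructor
  · intro h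
    -- The family is only known to come from some extended solution; being based at `1`, that
    -- solution must coincide with `Φ`.
    obtain ⟨Φ', hΦ', heq⟩ := h.exists_eq (F := fun l p => (Φ l p : Matrix (Fin n) (Fin n) ℂ))
      (fun q => rfl) hF.continuous_loop (fun l q => (Φ l q).2) h1
    exact ExtSol.isCyclicSuperhorizontal_frame hk hζ hF hS fun e he =>
      hΦ'.exists_coordDeriv_eq heq he
  · intro h
    refine ⟨Φ, ⟨hΦ, hΦ_one, fun e he => ?_⟩, fun p => rfl⟩
    have hex : ∀ p, ∃ A : Matrix (Fin n) (Fin n) ℂ, p ∈ e.source → ∀ x : Circle,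
        ExtSol.coordDz (fun q => (Φ x q : Matrix (Fin n) (Fin n) ℂ)) e p =
          (1 - (x : ℂ)⁻¹) • ((Φ x p : Matrix (Fin n) (Fin n) ℂ) * A) := by
      intro p
      by_cases hp : p ∈ e.source
      · obtain ⟨A, hA⟩ := h.exists_coordDz_eq hk hζ hF hS he hp
        exact ⟨A, fun _ => hA⟩
      · exact ⟨0, fun h => absurd h hp⟩
    choose A hA using hex
    -- Unitarity dictates $A_{\bar z}=-A_z^*$.
    exact ⟨A, fun p => -star (A p), fun l p hp v => ExtSol.coordDeriv_of_coordDz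
      (fun i j => hF.differentiableAt he l i j hp) (fun q => (Φ l q).2) hp (hA p hp l) v⟩
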